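/- Let $0<h<T$, let $(\Omega,(\mathcal F_t)_{t\ge 0},\mathbb P)$ be a filtered probability space and let $W$ be a one-dimensional $(\mathcal F_t)$-Wiener process, i.e. a Brownian motion adapted to $(\mathcal F_t)$ such that $W_t-W_s$ is independent of $\mathcal F_s$ for all $0\le s\le t$. Let $A\in L^\infty([0,T],\mathbb R^{n\times n})$, $B\in L^\infty([0,T],\mathbb R^{n\times m})$, $r,\sigma\in L^\infty([0,T],\mathbb R^n)$ be deterministic, and let $\Phi_A(t,s)$, $s,t\in[0,T]$, be the fundamental matrix of $A$, i.e. the unique solution of $\frac{d}{dt}\Phi_A(t,s)=A(t)\Phi_A(t,s)$, $\Phi_A(s,s)=I$ (in the integrated, Carathéodory sense). Let $U$ be a square integrable $(\mathcal F_t)$-adapted $\mathbb R^m$-valued process on $[0,T]$, extended by $U(s)=0$ for $s\in[-h,0)$, and let $X$ be the (continuous, adapted) solution on $[0,T]$ of $$dX(t)=\bigl(A(t)X(t)+B(t)U(t-h)+r(t)\bigr)\,dt+\sigma(t)\,dW_t,\qquad X(0)=0 .$$ Let $$Y(t)=X(t)+\int_{t-h}^{t}\Phi_A(t,s+h)B(s+h)U(s)\,ds$$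 be the Artstein transform of $X$. For a process $Z$ write $\Sigma_Z(t)=\mathbb E\bigl[(Z(t)-\mathbb E Z(t))(Z(t)-\mathbb E Z(t))^T\bigr]$. Then for all $t\in[h,T]$ the random vectors $X(t)$ and $Y(t-h)$ are square integrable and $$\Sigma_X(t)=\Phi_A(t,t-h)\,\Sigma_Y(t-h)\,\Phi_A(t,t-h)^T+\Sigma_{\min}(t),\qquad \Sigma_{\min}(t)=\int_{t-h}^{t}\Phi_A(t,s)\sigma(s)\sigma(s)^T\Phi_A(t,s)^T\,ds .$$ -/

import Mathlib

open MeasureTheory ProbabilityTheory Filter Set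
open scoped ENNReal NNReal Topology Matrix

namespace DelayedSDE

/-! ### Auxiliary estimates for the linear integral equation `y(t) = c + ∫_s^t a(u) y(u) du` -/

section IntegralEquation

theorem norm_integral_mul_le {R : Type*} [NormedRing R] [NormedAlgebra ℝ R] (a y : ℝ → R) (K C : ℝ) (hK0 : 0 ≤ K) (hC : 0 ≤ C)
    (hK : ∀ᵐ u, ‖a u‖ ≤ K) (s t : ℝ) (k : ℕ)
    (hy : ∀ u ∈ uIcc s t, ‖y u‖ ≤ C * (K * |u - s|) ^ k / (k.factorial : ℝ)) :
    ‖∫ u in s..t, a u * y u‖ ≤ C * (K * |t - s|) ^ (k + 1) / ((k + 1).factorial : ℝ) := by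
  have h1 : ‖∫ u in s..t, a u * y u‖ ≤
      ∫ u in uIoc s t, (K * (C * K ^ k / (k.factorial : ℝ))) * |u - s| ^ k := by
    rw [intervalIntegral.norm_intervalIntegral_eq]
    apply norm_integral_le_of_norm_le
    · have : Continuous (fun u : ℝ => (K * (C * K ^ k / (k.factorial : ℝ))) * |u - s| ^ k) := by
        fun_prop
      exact (this.intervalIntegrable s t).def'
    · filter_upwards [ae_restrict_mem measurableSet_uIoc, ae_restrict_of_ae hK] with u hu hKu
      calc ‖a u * y u‖ ≤ ‖a u‖ * ‖y u‖ := norm_mul_le _ _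
        _ ≤ K * (C * (K * |u - s|) ^ k / (k.factorial : ℝ)) := by
            gcongr
            exact hy u (uIoc_subset_uIcc hu)
        _ = _ := by rw [mul_pow]; ring
  refine h1.trans (le_of_eq ?_)
  rw [integral_const_mul, integral_pow_abs_sub_uIoc, mul_pow, Nat.factorial_succ]
  push_cast
  field_simp
  ring

theorem intervalIntegrable_mul_of_bound {R : Type*} [NormedRing R] (a y : ℝ → R) (K : ℝ)
    (hm : AEStronglyMeasurable a volume) (hK : ∀ᵐ u, ‖a u‖ ≤ K) (s t : ℝ)
    (hy : ContinuousOn y (uIcc s t)) :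
    IntervalIntegrable (fun u => a u * y u) volume s t := by
  have ha : IntervalIntegrable a volume s t := by
    rw [intervalIntegrable_iff]
    exact Measure.integrableOn_of_bounded (M := K) (by simp) hm
      (ae_restrict_of_ae hK)
  exact ha.mul_continuousOn hy

theorem linearMap_intervalIntegral {R : Type*} [NormedRing R] [NormedAlgebra ℝ R]
    [FiniteDimensional ℝ R] (L : R →ₗ[ℝ] ℝ) (f : ℝ → R) (s t : ℝ)
    (hf : IntervalIntegrable f volume s t) :
    L (∫ u in s..t, f u) = ∫ u in s..t, L (f u) := by
  have : CompleteSpace R := FiniteDimensional.complete ℝ R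
  exact ((LinearMap.toContinuousLinearMap L).intervalIntegral_comp_comm hf).symm

/-- The Picard iterates (terms of the Peano–Baker series). -/
noncomputable def picardTerm {R : Type*} [NormedRing R] [NormedAlgebra ℝ R] (a : ℝ → R) (s : ℝ) : ℕ → ℝ → R
  | 0 => fun _ => 1
  | k + 1 => fun t => ∫ u in s..t, a u * picardTerm a s k u

theorem exists_integral_solution {R : Type*} [NormedRing R] [NormedAlgebra ℝ R] [CompleteSpace R] (a : ℝ → R) (K : ℝ) (hK0 : 0 ≤ K)
    (hm : AEStronglyMeasurable a volume) (hK : ∀ᵐ u, ‖a u‖ ≤ K) (s : ℝ) :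
    ∃ y : ℝ → R, Continuous y ∧ ∀ t, y t = 1 + ∫ u in s..t, a u * y u := by
  have hcont : ∀ k, Continuous (picardTerm a s k) := by
    intro k
    induction k with
    | zero => exact continuous_const
    | succ k ih =>
      exact intervalIntegral.continuous_primitive
        (fun p q => intervalIntegrable_mul_of_bound a _ K hm hK p q ih.continuousOn) s
  have hbd : ∀ k t, ‖picardTerm a s k t‖ ≤ ‖(1 : R)‖ * (K * |t - s|) ^ k / (k.factorial : ℝ) := by
    intro k
    induction k with
    | zero => intro t; simp [picardTerm]
    | succ k ih =>
      intro t
      exact norm_integral_mul_le a _ K _ hK0 (norm_nonneg _) hK s t k (fun u _ => ih u)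
  have hsum : ∀ M : ℝ, Summable (fun k : ℕ => ‖(1 : R)‖ * (K * M) ^ k / (k.factorial : ℝ)) := by
    intro M
    have := (Real.summable_pow_div_factorial (K * M)).mul_left ‖(1 : R)‖
    simpa [mul_div_assoc] using this
  have hbd' : ∀ M k t, |t - s| ≤ M →
      ‖picardTerm a s k t‖ ≤ ‖(1 : R)‖ * (K * M) ^ k / (k.factorial : ℝ) := by
    intro M k t ht
    refine (hbd k t).trans ?_
    gcongr
  have hsumm : ∀ t, Summable (fun k => picardTerm a s k t) := fun t =>
    Summable.of_norm_bounded (hsum |t - s|) (fun k => hbd k t)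
  refine ⟨fun t => ∑' k, picardTerm a s k t, ?_, ?_⟩
  · rw [continuous_iff_continuousAt]
    intro t
    have hball : ContinuousOn (fun t => ∑' k, picardTerm a s k t) (Metric.ball s (|t - s| + 1)) := by
      refine continuousOn_tsum (fun k => (hcont k).continuousOn) (hsum (|t - s| + 1)) ?_
      intro k x hx
      refine hbd' _ k x ?_
      rw [Metric.mem_ball, Real.dist_eq] at hx
      exact hx.le
    refine hball.continuousAt (Metric.isOpen_ball.mem_nhds ?_)
    rw [Metric.mem_ball, Real.dist_eq]
    linarith
  · intro t
    have hs := intervalIntegral.hasSum_integral_of_dominated_convergence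
      (μ := volume) (a := s) (b := t)
      (F := fun k u => a u * picardTerm a s k u) (f := fun u => a u * ∑' k, picardTerm a s k u)
      (fun k _ => K * (‖(1 : R)‖ * (K * |t - s|) ^ k / (k.factorial : ℝ)))
      (fun k => (intervalIntegrable_mul_of_bound a _ K hm hK s t
        (hcont k).continuousOn).def'.aestronglyMeasurable)
      (fun k => by
        filter_upwards [hK] with u hu hmem
        refine (norm_mul_le _ _).trans ?_
        gcongr
        refine hbd' _ k u ?_
        have := abs_sub_left_of_mem_uIcc (uIoc_subset_uIcc hmem)
        exact this)
      (ae_of_all _ fun u _ => (hsum _).mul_left K)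
      intervalIntegrable_const
      (ae_of_all _ fun u _ => (hsumm u).hasSum.mul_left (a u))
    show ∑' k, picardTerm a s k t = _
    rw [(hsumm t).tsum_eq_zero_add, ← hs.tsum_eq]
    rfl

theorem eq_zero_of_integral_equation {R : Type*} [NormedRing R] [NormedAlgebra ℝ R]
    (a d : ℝ → R) (K : ℝ) (hK0 : 0 ≤ K)
    (hK : ∀ᵐ u, ‖a u‖ ≤ K) (s t : ℝ) (hd : ContinuousOn d (uIcc s t))
    (h : ∀ v ∈ uIcc s t, d v = ∫ u in s..v, a u * d u) : d t = 0 := by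
  obtain ⟨C, hC⟩ := isCompact_uIcc.exists_bound_of_continuousOn hd
  have hC0 : 0 ≤ C := (norm_nonneg _).trans (hC s left_mem_uIcc)
  have key : ∀ k : ℕ, ∀ v ∈ uIcc s t, ‖d v‖ ≤ C * (K * |v - s|) ^ k / (k.factorial : ℝ) := by
    intro k
    induction k with
    | zero => intro v hv; simpa using hC v hv
    | succ k ih =>
      intro v hv
      rw [h v hv]
      exact norm_integral_mul_le a d K C hK0 hC0 hK s v k
        (fun u hu => ih u (uIcc_subset_uIcc_left hv hu))
  have hlim : Tendsto (fun k : ℕ => C * (K * |t - s|) ^ k / (k.factorial : ℝ)) atTop (𝓝 0) := by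
    have := (FloorSemiring.tendsto_pow_div_factorial_atTop (K * |t - s|)).const_mul C
    simpa [mul_div_assoc] using this
  have := ge_of_tendsto' hlim (fun k => key k t right_mem_uIcc)
  exact norm_le_zero_iff.1 this

end IntegralEquation

/-! ### Coefficients and the fundamental matrix -/

/-- `M ∈ L^∞([0,T], ℝ^{p×q})`. -/
def MatrixLInfty {p q : ℕ} (T : ℝ) (M : ℝ → Matrix (Fin p) (Fin q) ℝ) : Prop :=
  ∀ i j, MemLp (fun t => M t i j) ∞ (volume.restrict (Icc 0 T))

/-- `v ∈ L^∞([0,T], ℝ^p)`. -/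
def VectorLInfty {p : ℕ} (T : ℝ) (v : ℝ → Fin p → ℝ) : Prop :=
  MemLp v ∞ (volume.restrict (Icc 0 T))

/-- `Φ` solves `dΦ/dt(t,s) = A(t) Φ(t,s)`, `Φ(s,s) = I` for `s, t ∈ [0,T]`. As `A` is only in
`L^∞`, the equation is understood in the sense of Carathéodory, that is, in integrated form. -/
structure IsFundamentalMatrix {n : ℕ} (T : ℝ) (A : ℝ → Matrix (Fin n) (Fin n) ℝ)
    (Φ : ℝ → ℝ → Matrix (Fin n) (Fin n) ℝ) : Prop where
  continuousOn : ∀ s ∈ Icc 0 T, ContinuousOn (fun t => Φ t s) (Icc 0 T)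
  equation : ∀ s ∈ Icc 0 T, ∀ t ∈ Icc 0 T, ∀ i j,
    Φ t s i j = (1 : Matrix (Fin n) (Fin n) ℝ) i j + ∫ u in s..t, (A u * Φ u s) i j

/-- The fundamental matrix `Φ_A(t,s)`, `s, t ∈ [0,T]`, of `A ∈ L^∞([0,T], ℝ^{n×n})`. It exists
and is unique on `[0,T] × [0,T]`, see `isFundamentalMatrix_fundamentalMatrix` and
`IsFundamentalMatrix.unique`. -/
noncomputable def fundamentalMatrix {n : ℕ} (T : ℝ) (A : ℝ → Matrix (Fin n) (Fin n) ℝ) :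
    ℝ → ℝ → Matrix (Fin n) (Fin n) ℝ :=
  Classical.epsilon (IsFundamentalMatrix T A)

section FundamentalMatrix

attribute [local instance] Matrix.linftyOpNormedRing Matrix.linftyOpNormedAlgebra

variable {n : ℕ} {T : ℝ} {A : ℝ → Matrix (Fin n) (Fin n) ℝ}

theorem exists_bounded_extension (hA : MatrixLInfty T A) :
    ∃ (a : ℝ → Matrix (Fin n) (Fin n) ℝ) (K : ℝ), 0 ≤ K ∧ AEStronglyMeasurable a volume ∧
      (∀ᵐ u, ‖a u‖ ≤ K) ∧ ∀ u ∈ Icc 0 T, a u = A u := by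
  have hmeas : AEStronglyMeasurable A (volume.restrict (Icc 0 T)) := by
    have h1 : AEMeasurable (fun t i j => A t i j) (volume.restrict (Icc 0 T)) :=
      aemeasurable_pi_lambda _ fun i => aemeasurable_pi_lambda _ fun j => (hA i j).1.aemeasurable
    exact h1.aestronglyMeasurable
  have hb : ∀ i j, ∃ K : ℝ, 0 ≤ K ∧ ∀ᵐ u ∂(volume.restrict (Icc 0 T)), ‖A u i j‖ ≤ K := by
    intro i j
    refine ⟨(eLpNormEssSup (fun t => A t i j) (volume.restrict (Icc 0 T))).toReal,
      ENNReal.toReal_nonneg, ?_⟩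
    have h2 := (hA i j).2
    rw [eLpNorm_exponent_top] at h2
    filter_upwards [ae_le_eLpNormEssSup (f := fun t => A t i j)
      (μ := volume.restrict (Icc 0 T))] with u hu
    have := ENNReal.toReal_mono h2.ne hu
    simpa using this
  choose K hK0 hK using hb
  refine ⟨(Icc 0 T).indicator A, ∑ i, ∑ j, K i j,
    Finset.sum_nonneg fun i _ => Finset.sum_nonneg fun j _ => hK0 i j,
    (aestronglyMeasurable_indicator_iff measurableSet_Icc).2 hmeas, ?_,
    fun u hu => indicator_of_mem hu _⟩
  have hall : ∀ᵐ u ∂(volume.restrict (Icc 0 T)), ∀ i j, ‖A u i j‖ ≤ K i j :=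
    ae_all_iff.2 fun i => ae_all_iff.2 fun j => hK i j
  rw [ae_restrict_iff' measurableSet_Icc] at hall
  filter_upwards [hall] with u hu
  by_cases hmem : u ∈ Icc 0 T
  · rw [indicator_of_mem hmem, Matrix.linfty_opNorm_def]
    have h3 : ∀ i, (∑ j, ‖A u i j‖₊ : ℝ≥0) ≤ ∑ i, ∑ j, ‖A u i j‖₊ := fun i =>
      Finset.single_le_sum (f := fun i => ∑ j, ‖A u i j‖₊) (fun _ _ => zero_le)
        (Finset.mem_univ i)
    have h4 : (Finset.univ.sup fun i => ∑ j, ‖A u i j‖₊) ≤ ∑ i, ∑ j, ‖A u i j‖₊ :=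
      Finset.sup_le fun i _ => h3 i
    refine (NNReal.coe_le_coe.2 h4).trans ?_
    push_cast
    exact Finset.sum_le_sum fun i _ => Finset.sum_le_sum fun j _ => hu hmem i j
  · rw [indicator_of_notMem hmem, norm_zero]
    exact Finset.sum_nonneg fun i _ => Finset.sum_nonneg fun j _ => hK0 i j

theorem exists_isFundamentalMatrix (hA : MatrixLInfty T A) :
    ∃ Φ, IsFundamentalMatrix T A Φ := by
  obtain ⟨a, K, hK0, hm, hK, haA⟩ := exists_bounded_extension hA
  choose y hyc hy using exists_integral_solution a K hK0 hm hK
  refine ⟨fun t s => y s t, fun s _ => (hyc s).continuousOn, ?_⟩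
  intro s hs t ht i j
  have hint := intervalIntegrable_mul_of_bound a (y s) K hm hK s t (hyc s).continuousOn
  have h1 := congrArg (Matrix.entryLinearMap ℝ ℝ i j) (hy s t)
  rw [map_add, linearMap_intervalIntegral _ _ _ _ hint] at h1
  refine h1.trans ?_
  show _ + _ = _ + _
  congr 1
  apply intervalIntegral.integral_congr
  intro u hu
  show (a u * y s u) i j = (A u * y s u) i j
  rw [haA u (uIcc_subset_Icc hs ht hu)]

theorem isFundamentalMatrix_fundamentalMatrix (hA : MatrixLInfty T A) :
    IsFundamentalMatrix T A (fundamentalMatrix T A) :=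
  Classical.epsilon_spec (exists_isFundamentalMatrix hA)

theorem IsFundamentalMatrix.unique (hA : MatrixLInfty T A)
    {Φ Ψ : ℝ → ℝ → Matrix (Fin n) (Fin n) ℝ} (hΦ : IsFundamentalMatrix T A Φ)
    (hΨ : IsFundamentalMatrix T A Ψ) {s t : ℝ} (hs : s ∈ Icc 0 T) (ht : t ∈ Icc 0 T) :
    Φ t s = Ψ t s := by
  obtain ⟨a, K, hK0, hm, hK, haA⟩ := exists_bounded_extension hA
  have hsub : uIcc s t ⊆ Icc 0 T := uIcc_subset_Icc hs ht
  have hΦc := (hΦ.continuousOn s hs).mono hsub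
  have hΨc := (hΨ.continuousOn s hs).mono hsub
  refine sub_eq_zero.1 (eq_zero_of_integral_equation a (fun v => Φ v s - Ψ v s) K hK0 hK s t
    (hΦc.sub hΨc) ?_)
  intro v hv
  have hsv : uIcc s v ⊆ uIcc s t := uIcc_subset_uIcc_left hv
  have i1 := intervalIntegrable_mul_of_bound a (fun u => Φ u s) K hm hK s v (hΦc.mono hsv)
  have i2 := intervalIntegrable_mul_of_bound a (fun u => Ψ u s) K hm hK s v (hΨc.mono hsv)
  have e : ∀ (Θ : ℝ → ℝ → Matrix (Fin n) (Fin n) ℝ), IsFundamentalMatrix T A Θ →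
      Θ v s = 1 + ∫ u in s..v, a u * Θ u s := by
    intro Θ hΘ
    have hint := intervalIntegrable_mul_of_bound a (fun u => Θ u s) K hm hK s v
      (((hΘ.continuousOn s hs).mono hsub).mono hsv)
    ext i j
    rw [hΘ.equation s hs v (hsub hv) i j]
    show _ = _ + Matrix.entryLinearMap ℝ ℝ i j (∫ u in s..v, a u * Θ u s)
    rw [linearMap_intervalIntegral _ _ _ _ hint]
    congr 1
    apply intervalIntegral.integral_congr
    intro u hu
    show (A u * Θ u s) i j = (a u * Θ u s) i j
    rw [haA u (hsub (hsv hu))]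
  show Φ v s - Ψ v s = _
  rw [e Φ hΦ, e Ψ hΨ, add_sub_add_left_eq_sub, ← intervalIntegral.integral_sub i1 i2]
  simp only [mul_sub]

end FundamentalMatrix

/-! ### Wiener process and stochastic integral of deterministic functions -/

section Stochastic

variable {Ω : Type*} {mΩ : MeasurableSpace Ω}

/-- `W` is a one-dimensional Wiener process with respect to the filtration `ℱ`: a Brownian motion
adapted to `ℱ` whose increments after time `s` are independent of `ℱ_s`. -/
structure IsWienerProcess (ℱ : Filtration ℝ≥0 mΩ) (P : Measure Ω) (W : ℝ≥0 → Ω → ℝ) : Prop where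
  isBrownian : IsBrownianReal W P
  adapted : ∀ t, Measurable[ℱ t] (W t)
  indep_increments : ∀ s t, s ≤ t →
    Indep (MeasurableSpace.comap (fun ω => W t ω - W s ω) inferInstance) (ℱ s) P

/-- An `ℝ^n`-valued step function `∑_i c_i 1_{(l_i, r_i]}` on `[0,∞)`. -/
structure StepFun (n : ℕ) where
  N : ℕ
  l : Fin N → ℝ≥0
  r : Fin N → ℝ≥0
  c : Fin N → Fin n → ℝ
  l_le_r : ∀ i, l i ≤ r i

namespace StepFun

variable {n : ℕ}

/-- The step function as a function of time. -/
noncomputable def toFun (φ : StepFun n) (s : ℝ) : Fin n → ℝ :=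
  ∑ i, (Ioc (φ.l i : ℝ) (φ.r i : ℝ)).indicator (fun _ => φ.c i) s

/-- All intervals of the step function lie in `(a, b]`. -/
def SupportedIn (φ : StepFun n) (a b : ℝ) : Prop :=
  ∀ i, a ≤ (φ.l i : ℝ) ∧ (φ.r i : ℝ) ≤ b

/-- The elementary stochastic integral `∑_i c_i (W_{r_i} - W_{l_i})`. -/
noncomputable def integral (φ : StepFun n) (W : ℝ≥0 → Ω → ℝ) (ω : Ω) : Fin n → ℝ :=
  ∑ i, (W (φ.r i) ω - W (φ.l i) ω) • φ.c i

end StepFun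

/-- `I` is (a version of) the Itô integral `∫_a^b f(s) dW_s` of the deterministic function `f`:
the `L²(P)`-limit of the elementary integrals of step functions that converge to `f` in
`L²((a,b])`. -/
def IsWienerIntegral {n : ℕ} (P : Measure Ω) (W : ℝ≥0 → Ω → ℝ) (f : ℝ → Fin n → ℝ) (a b : ℝ)
    (I : Ω → Fin n → ℝ) : Prop :=
  MemLp I 2 P ∧ ∃ φ : ℕ → StepFun n, (∀ k, (φ k).SupportedIn a b) ∧
    Tendsto (fun k => eLpNorm (fun s => (φ k).toFun s - f s) 2 (volume.restrict (Ioc a b)))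
      atTop (𝓝 0) ∧
    Tendsto (fun k => eLpNorm (fun ω => (φ k).integral W ω - I ω) 2 P) atTop (𝓝 0)

/-- The process `(Z(t))`, `t ∈ [0,T]`, is adapted to `ℱ`. -/
def AdaptedOn {r : ℕ} (ℱ : Filtration ℝ≥0 mΩ) (T : ℝ) (Z : ℝ → Ω → Fin r → ℝ) : Prop :=
  ∀ t : ℝ≥0, (t : ℝ) ≤ T → Measurable[ℱ t] (Z t)

/-- The space `L²_ℱ([0,T], ℝ^r)` of square integrable adapted processes. -/
structure MemL2Adapted {r : ℕ} (ℱ : Filtration ℝ≥0 mΩ) (P : Measure Ω) (T : ℝ)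
    (Z : ℝ → Ω → Fin r → ℝ) : Prop where
  adapted : AdaptedOn ℱ T Z
  memLp : MemLp (fun p : ℝ × Ω => Z p.1 p.2) 2 ((volume.restrict (Icc 0 T)).prod P)

/-- `X` is the solution on `[0,T]` of the delayed-input equation
`dX(t) = (A(t) X(t) + B(t) U(t-h) + r(t)) dt + σ(t) dW_t`, `X(0) = 0`, `U = 0` on `[-h,0)`:
a continuous adapted process satisfying the integrated equation almost surely at each time. -/
structure IsDelayedSolution {n m : ℕ} (ℱ : Filtration ℝ≥0 mΩ) (P : Measure Ω) (W : ℝ≥0 → Ω → ℝ)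
    (T h : ℝ) (A : ℝ → Matrix (Fin n) (Fin n) ℝ) (B : ℝ → Matrix (Fin n) (Fin m) ℝ)
    (r σ : ℝ → Fin n → ℝ) (U : ℝ → Ω → Fin m → ℝ) (X : ℝ → Ω → Fin n → ℝ) : Prop where
  adapted : AdaptedOn ℱ T X
  continuousOn : ∀ᵐ ω ∂P, ContinuousOn (fun t => X t ω) (Icc 0 T)
  initial : ∀ᵐ ω ∂P, X 0 ω = 0
  control_prehistory : ∀ s ∈ Ico (-h) 0, ∀ ω, U s ω = 0
  equation : ∀ t ∈ Icc 0 T, ∃ I : Ω → Fin n → ℝ, IsWienerIntegral P W σ 0 t I ∧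
    ∀ᵐ ω ∂P, X t ω = (∫ s in 0..t, (A s *ᵥ X s ω + B s *ᵥ U (s - h) ω + r s)) + I ω

/-- The Artstein transform
`Y(t) = X(t) + ∫_{t-h}^t Φ_A(t,s+h) B(s+h) U(s) ds`. -/
noncomputable def artsteinTransform {n m : ℕ} (T h : ℝ) (A : ℝ → Matrix (Fin n) (Fin n) ℝ)
    (B : ℝ → Matrix (Fin n) (Fin m) ℝ) (U : ℝ → Ω → Fin m → ℝ) (X : ℝ → Ω → Fin n → ℝ)
    (t : ℝ) (ω : Ω) : Fin n → ℝ :=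
  X t ω + ∫ s in (t - h)..t, (fundamentalMatrix T A t (s + h) * B (s + h)) *ᵥ U s ω

/-- The covariance matrix `Σ_Z(t) = E[(Z(t) - E Z(t)) (Z(t) - E Z(t))ᵀ]`. -/
noncomputable def covMatrix {r : ℕ} (P : Measure Ω) (Z : ℝ → Ω → Fin r → ℝ) (t : ℝ) :
    Matrix (Fin r) (Fin r) ℝ :=
  Matrix.of fun i j => cov[fun ω => Z t ω i, fun ω => Z t ω j; P]

end Stochastic

/-- `Σ_min(t) = ∫_{t-h}^t Φ_A(t,s) σ(s) σ(s)ᵀ Φ_A(t,s)ᵀ ds`, entry by entry. -/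
noncomputable def sigmaMin {n : ℕ} (T h : ℝ) (A : ℝ → Matrix (Fin n) (Fin n) ℝ)
    (σ : ℝ → Fin n → ℝ) (t : ℝ) : Matrix (Fin n) (Fin n) ℝ :=
  Matrix.of fun i j => ∫ s in (t - h)..t,
    (fundamentalMatrix T A t s * Matrix.vecMulVec (σ s) (σ s) * (fundamentalMatrix T A t s)ᵀ) i j

end DelayedSDE

/-!
# Covariance of a linear system with delayed control

Put `τ = t - h`. Applying variation of constants to the paths of `X` on `[τ, t]`, one finds
`X(t) = Φ_A(t,τ) Y(τ) + ∫_τ^t Φ_A(t,s) r(s) ds + N`, where `Y` is the Artstein transform: the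
control acting on `(τ, t]` was chosen up to time `τ`, and the cocycle property of `Φ_A` identifies
its contribution with that of the integral in `Y(τ)`
(`IsDelayedSolution.ae_eq_add_accumulatedNoise`). The middle term is deterministic, so the identity
follows once `N` is centred, uncorrelated with `Y(τ)`, and has covariance matrix `Σ_min(t)`.

The variable `N` is a version of `∫_τ^t Φ_A(t,s) σ(s) dW_s`, but neither a stochastic Fubini
theorem nor stochastic integration by parts is needed to handle it. With `J(u)` denoting `X(u)`
minus its drift, a continuous version of `∫_0^u σ dW`, the pathwise argument gives
`N = D(t) + ∫_τ^t Φ_A(t,u) A(u) D(u) du`, `D(u) = J(u) - J(τ)` (`eq_add_terminalValue`). This is a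
fixed linear functional `terminalValue` of the process `D`.

* Covariance of `N`. By Fubini's theorem the second moments of `terminalValue` depend only on the
  covariance function of the process (`integral_terminalValue_mul_congr`). By the Itô isometry, `D`
  has the same covariance function as `u ↦ 1_{(τ,u]} σ` in `L²((τ,t])`, and the functional maps
  the latter to `s ↦ Φ_A(t,s) σ(s)`, by the backward equation for `Φ_A`.
* Orthogonality of `N` and `Y(τ)`. Every `D(u)` is orthogonal to the square integrable
  `ℱ_τ`-measurable variables, hence so is `N`. As `X(τ)` and `U(s)`, for almost every `s ≤ τ`, are such
  variables, Fubini's theorem extends this to `Y(τ)`; in this way no progressively measurable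
  version of `U` is required.
-/

namespace DelayedSDE

/-! ### Square integrable processes -/

section SquareIntegrable

variable {Ω : Type*} {mΩ : MeasurableSpace Ω} {P : Measure Ω}

theorem integrable_mul_of_memLp_two {α : Type*} {mα : MeasurableSpace α} {μ : Measure α}
    {f g : α → ℝ} (hf : MemLp f 2 μ) (hg : MemLp g 2 μ) :
    Integrable (fun x => f x * g x) μ := MeasureTheory.MemLp.integrable_mul hf hg

theorem integral_sub_mul_sub {α : Type*} {mα : MeasurableSpace α} {μ : Measure α}
    {f f' g g' : α → ℝ} (hf : MemLp f 2 μ) (hf' : MemLp f' 2 μ) (hg : MemLp g 2 μ)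
    (hg' : MemLp g' 2 μ) :
    ∫ x, (f x - f' x) * (g x - g' x) ∂μ = (∫ x, f x * g x ∂μ - ∫ x, f x * g' x ∂μ) -
      (∫ x, f' x * g x ∂μ - ∫ x, f' x * g' x ∂μ) := by
  have i1 := integrable_mul_of_memLp_two hf hg
  have i2 := integrable_mul_of_memLp_two hf hg'
  have i3 := integrable_mul_of_memLp_two hf' hg
  have i4 := integrable_mul_of_memLp_two hf' hg'
  have i12 : Integrable (fun x => f x * g x - f x * g' x) μ := i1.sub i2
  have i34 : Integrable (fun x => f' x * g x - f' x * g' x) μ := i3.sub i4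
  rw [← integral_sub i1 i2, ← integral_sub i3 i4, ← integral_sub i12 i34]
  congr 1
  ext x
  ring

/-- A process with almost surely continuous paths is jointly measurable, up to null sets: it is
the pointwise limit of its discretizations in time. -/
theorem aestronglyMeasurable_prod_of_continuousOn [SFinite P] {T : ℝ} {Z : ℝ → Ω → ℝ}
    (hZ : ∀ u ∈ Icc 0 T, AEStronglyMeasurable (Z u) P)
    (hc : ∀ᵐ ω ∂P, ContinuousOn (fun u => Z u ω) (Icc 0 T)) :
    AEStronglyMeasurable (fun p : ℝ × Ω => Z p.1 p.2) ((volume.restrict (Icc 0 T)).prod P) := by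
  set ν : Measure ℝ := volume.restrict (Icc 0 T) with hν
  -- Times are rounded down to multiples of `1 / k`, which keeps them in `[0, T]`.
  let d : ℕ → ℝ → ℝ := fun k u => (⌊u * (k : ℝ)⌋₊ : ℝ) / k
  have hd : ∀ k, ∀ u ∈ Icc 0 T, d k u ∈ Icc 0 T := by
    intro k u hu
    refine ⟨by positivity, le_trans ?_ hu.2⟩
    rcases Nat.eq_zero_or_pos k with rfl | hk
    · simpa [d] using hu.1
    · have hk' : (0 : ℝ) < k := by exact_mod_cast hk
      rw [div_le_iff₀ hk']
      exact Nat.floor_le (mul_nonneg hu.1 hk'.le)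
  have hmem : ∀ᵐ p : ℝ × Ω ∂(ν.prod P), p.1 ∈ Icc 0 T :=
    Measure.quasiMeasurePreserving_fst.ae (ae_restrict_mem measurableSet_Icc)
  have hcont : ∀ᵐ p : ℝ × Ω ∂(ν.prod P), ContinuousOn (fun u => Z u p.2) (Icc 0 T) :=
    Measure.quasiMeasurePreserving_snd.ae hc
  have hmeas : ∀ k : ℕ, AEStronglyMeasurable
      (fun p : ℝ × Ω => (Icc 0 T).indicator (fun u => Z (d k u) p.2) p.1) (ν.prod P) := by
    intro k
    let S : ℕ → Set (ℝ × Ω) := fun i => (fun p : ℝ × Ω => ⌊p.1 * (k : ℝ)⌋₊) ⁻¹' {i}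
    have hS : ∀ i, MeasurableSet (S i) := fun i =>
      (Nat.measurable_floor.comp (measurable_fst.mul_const _)) (measurableSet_singleton i)
    have hU : ⋃ i, S i = univ := by
      ext p
      simp [S]
    rw [← Measure.restrict_univ (μ := ν.prod P), ← hU, aestronglyMeasurable_iUnion_iff]
    intro i
    have hae : (fun p : ℝ × Ω => (Icc 0 T).indicator (fun _ => Z ((i : ℝ) / k) p.2) p.1)
        =ᵐ[(ν.prod P).restrict (S i)]
        fun p => (Icc 0 T).indicator (fun u => Z (d k u) p.2) p.1 := by
      filter_upwards [ae_restrict_mem (hS i)] with p hp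
      have hp' : ⌊p.1 * (k : ℝ)⌋₊ = i := hp
      by_cases h : p.1 ∈ Icc 0 T
      · simp only [indicator_of_mem h, d, hp']
      · simp only [indicator_of_notMem h]
    by_cases hi : (i : ℝ) / k ∈ Icc 0 T
    · refine AEStronglyMeasurable.congr ?_ hae
      refine AEStronglyMeasurable.restrict ?_
      have := ((hZ _ hi).comp_snd (μ := ν)).indicator (measurable_fst measurableSet_Icc :
        MeasurableSet ((Prod.fst : ℝ × Ω → ℝ) ⁻¹' (Icc 0 T)))
      exact this
    · refine (aestronglyMeasurable_const (b := (0 : ℝ))).congr ?_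
      filter_upwards [ae_restrict_mem (hS i)] with p hp
      have hp' : ⌊p.1 * (k : ℝ)⌋₊ = i := hp
      by_cases h : p.1 ∈ Icc 0 T
      · refine absurd ?_ hi
        have := hd k _ h
        simpa only [d, hp'] using this
      · simp only [indicator_of_notMem h]
  refine aestronglyMeasurable_of_tendsto_ae atTop hmeas ?_
  filter_upwards [hmem, hcont] with p hp hpc
  simp only [indicator_of_mem hp]
  have hlim : Tendsto (fun k : ℕ => d k p.1) atTop (𝓝 p.1) :=
    (tendsto_nat_floor_mul_div_atTop hp.1).comp tendsto_natCast_atTop_atTop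
  exact (hpc p.1 hp).tendsto.comp (tendsto_nhdsWithin_iff.2
    ⟨hlim, Eventually.of_forall fun k => hd k _ hp⟩)

variable {ν : Measure ℝ}

theorem memLp_prod_bdd_mul {F : ℝ → Ω → ℝ} {k : ℝ → ℝ} [SFinite P]
    (hk : MemLp k ∞ ν) (hF : MemLp (fun p : ℝ × Ω => F p.1 p.2) 2 (ν.prod P)) :
    MemLp (fun p : ℝ × Ω => k p.1 * F p.1 p.2) 2 (ν.prod P) := by
  have hk' : ∀ᵐ u ∂ν, ‖k u‖ ≤ (eLpNorm k ∞ ν).toReal := by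
    have h2 := hk.2
    rw [eLpNorm_exponent_top] at h2 ⊢
    filter_upwards [ae_le_eLpNormEssSup (f := k) (μ := ν)] with u hu
    have := ENNReal.toReal_mono h2.ne hu
    simpa using this
  exact hF.of_le_mul (hk.1.comp_fst.mul hF.1) (c := (eLpNorm k ∞ ν).toReal) (by
    filter_upwards [Measure.quasiMeasurePreserving_fst.ae hk'] with p hp
    rw [norm_mul]
    gcongr)

variable [IsFiniteMeasure ν]

/-- A jointly measurable process whose second moments are bounded in time is square integrable in
time and probability. -/
theorem memLp_prod_of_integral_sq_le [SFinite P] {F : ℝ → Ω → ℝ} {C : ℝ}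
    (hm : AEStronglyMeasurable (fun p : ℝ × Ω => F p.1 p.2) (ν.prod P))
    (h2 : ∀ᵐ u ∂ν, MemLp (F u) 2 P) (hC : ∀ᵐ u ∂ν, ∫ ω, F u ω * F u ω ∂P ≤ C) :
    MemLp (fun p : ℝ × Ω => F p.1 p.2) 2 (ν.prod P) := by
  have hm2 : AEStronglyMeasurable (fun p : ℝ × Ω => F p.1 p.2 ^ 2) (ν.prod P) := hm.pow 2
  rw [memLp_two_iff_integrable_sq hm, integrable_prod_iff hm2]
  constructor
  · filter_upwards [h2] with u hu using hu.integrable_sq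
  · refine Integrable.of_bound (C := C) hm2.norm.integral_prod_right' ?_
    filter_upwards [hC] with u hu
    have : ∫ ω, ‖F u ω ^ 2‖ ∂P = ∫ ω, F u ω * F u ω ∂P := by
      congr 1; ext ω; rw [Real.norm_eq_abs, abs_of_nonneg (sq_nonneg _), sq]
    rw [this, Real.norm_eq_abs, abs_of_nonneg (integral_nonneg fun ω => mul_self_nonneg _)]
    exact hu

/-- The Cauchy–Schwarz inequality against the constant `1`. -/
theorem sq_integral_le (f : ℝ → ℝ) (hf : MemLp f 2 ν) :
    (∫ u, f u ∂ν) ^ 2 ≤ ν.real univ * ∫ u, f u ^ 2 ∂ν := by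
  have hi : Integrable f ν := hf.integrable (by norm_num)
  have hi2 : Integrable (fun u => f u ^ 2) ν := hf.integrable_sq
  set m := ν.real univ with hm
  set I := ∫ u, f u ∂ν with hI
  have hm0 : 0 ≤ m := measureReal_nonneg
  rcases hm0.eq_or_lt with h0 | hpos
  · have : ν = 0 := by
      rw [← Measure.measure_univ_eq_zero]
      exact (measureReal_eq_zero_iff).1 (hm ▸ h0.symm)
    simp [hI, this]
  · -- Up to the factor `m`, the variance of `f` is nonnegative.
    have h : 0 ≤ ∫ u, (m * f u - I) ^ 2 ∂ν := integral_nonneg fun u => sq_nonneg _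
    have e : ∫ u, (m * f u - I) ^ 2 ∂ν = m * (m * ∫ u, f u ^ 2 ∂ν - I ^ 2) := by
      have e1 : ∀ u, (m * f u - I) ^ 2 = m ^ 2 * f u ^ 2 - (2 * m * I) * f u + I ^ 2 := fun u => by
        ring
      simp only [e1]
      have i1 : Integrable (fun u => m ^ 2 * f u ^ 2 - (2 * m * I) * f u) ν :=
        (hi2.const_mul _).sub (hi.const_mul _)
      rw [integral_add i1 (integrable_const _), integral_sub (hi2.const_mul _) (hi.const_mul _),
        integral_const_mul, integral_const_mul,
        integral_const, smul_eq_mul, ← hm, ← hI]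
      ring
    rw [e] at h
    have := nonneg_of_mul_nonneg_right h hpos
    linarith

theorem memLp_integral_of_memLp_prod [SFinite P] {F : ℝ → Ω → ℝ}
    (hF : MemLp (fun p : ℝ × Ω => F p.1 p.2) 2 (ν.prod P)) :
    MemLp (fun ω => ∫ u, F u ω ∂ν) 2 P := by
  have hm : AEStronglyMeasurable (fun q : Ω × ℝ => F q.2 q.1) (P.prod ν) := hF.1.prod_swap
  have hm' : AEStronglyMeasurable (fun ω => ∫ u, F u ω ∂ν) P := hm.integral_prod_right'
  have hsq := hF.integrable_sq.swap
  rw [memLp_two_iff_integrable_sq hm']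
  refine (hsq.integral_prod_left.const_mul (ν.real univ)).mono' (hm'.pow 2) ?_
  filter_upwards [hsq.prod_right_ae, hm.prodMk_left] with ω h1 h2
  rw [Real.norm_eq_abs, abs_of_nonneg (sq_nonneg _)]
  exact sq_integral_le _ ((memLp_two_iff_integrable_sq h2).2 h1)

theorem ae_memLp_of_memLp_prod [SFinite P] {F : ℝ → Ω → ℝ}
    (hF : MemLp (fun p : ℝ × Ω => F p.1 p.2) 2 (ν.prod P)) :
    ∀ᵐ u ∂ν, MemLp (F u) 2 P := by
  filter_upwards [hF.integrable_sq.prod_right_ae, hF.1.prodMk_left] with u h1 h2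
  exact (memLp_two_iff_integrable_sq h2).2 h1

theorem ae_integrable_of_memLp_prod [IsFiniteMeasure P] {F : ℝ → Ω → ℝ}
    (hF : MemLp (fun p : ℝ × Ω => F p.1 p.2) 2 (ν.prod P)) :
    ∀ᵐ ω ∂P, Integrable (fun u => F u ω) ν :=
  (hF.integrable (by norm_num)).swap.prod_right_ae

/-- Fubini's theorem for the pairing of a square integrable variable with a time integral. -/
theorem integral_mul_integral_comm [IsFiniteMeasure P] {F : ℝ → Ω → ℝ} {Z : Ω → ℝ}
    (hZ : MemLp Z 2 P) (hF : MemLp (fun p : ℝ × Ω => F p.1 p.2) 2 (ν.prod P)) :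
    ∫ ω, Z ω * ∫ u, F u ω ∂ν ∂P = ∫ u, ∫ ω, Z ω * F u ω ∂P ∂ν := by
  have hZ' : MemLp (fun p : ℝ × Ω => Z p.2) 2 (ν.prod P) := hZ.comp_snd ν
  have hi : Integrable (fun p : ℝ × Ω => Z p.2 * F p.1 p.2) (ν.prod P) := hZ'.integrable_mul hF
  rw [integral_integral_swap (f := fun u ω => Z ω * F u ω) hi]
  simp only [integral_const_mul]

/-- Continuity of the inner product of `L²`, for sequences of functions rather than classes. -/
theorem tendsto_integral_mul_of_tendsto_eLpNorm {α : Type*} {mα : MeasurableSpace α}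
    {μ : Measure α} {f g : ℕ → α → ℝ} {f' g' : α → ℝ}
    (hf : ∀ k, MemLp (f k) 2 μ) (hf' : MemLp f' 2 μ)
    (hg : ∀ k, MemLp (g k) 2 μ) (hg' : MemLp g' 2 μ)
    (hfl : Tendsto (fun k => eLpNorm (f k - f') 2 μ) atTop (𝓝 0))
    (hgl : Tendsto (fun k => eLpNorm (g k - g') 2 μ) atTop (𝓝 0)) :
    Tendsto (fun k => ∫ x, f k x * g k x ∂μ) atTop (𝓝 (∫ x, f' x * g' x ∂μ)) := by
  have h1 := (Lp.tendsto_Lp_iff_tendsto_eLpNorm'' f hf f' hf').2 hfl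
  have h2 := (Lp.tendsto_Lp_iff_tendsto_eLpNorm'' g hg g' hg').2 hgl
  have h3 := h1.inner (𝕜 := ℝ) h2
  have e : ∀ {a b : α → ℝ} (ha : MemLp a 2 μ) (hb : MemLp b 2 μ),
      inner ℝ (ha.toLp a) (hb.toLp b) = ∫ x, a x * b x ∂μ := by
    intro a b ha hb
    rw [L2.inner_def]
    refine integral_congr_ae ?_
    filter_upwards [ha.coeFn_toLp, hb.coeFn_toLp] with x hx hy
    rw [hx, hy]
    simp [mul_comm]
  simpa only [e] using h3

end SquareIntegrable

/-! ### The fundamental matrix and variation of constants -/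

section VariationOfConstants

/-- The product rule for two functions given as primitives of integrable functions. -/
theorem mul_sub_mul_eq_integral_of_primitive {f g f' g' : ℝ → ℝ} {s t : ℝ}
    (hf' : IntervalIntegrable f' volume s t) (hg' : IntervalIntegrable g' volume s t)
    (hf : ∀ u ∈ uIcc s t, f u = f s + ∫ v in s..u, f' v)
    (hg : ∀ u ∈ uIcc s t, g u = g s + ∫ v in s..u, g' v) :
    f t * g t - f s * g s = ∫ u in s..t, (f' u * g u + f u * g' u) := by
  have hac : ∀ {q : ℝ → ℝ} (c : ℝ), IntervalIntegrable q volume s t →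
      AbsolutelyContinuousOnInterval (fun u => c + ∫ v in s..u, q v) s t := fun c hq =>
    ((LipschitzWith.const c).lipschitzOnWith.absolutelyContinuousOnInterval).fun_add
      (hq.absolutelyContinuousOnInterval_intervalIntegral left_mem_uIcc)
  have key := AbsolutelyContinuousOnInterval.integral_deriv_mul_eq_sub
    (hac (f s) hf') (hac (g s) hg')
  have e := hf t right_mem_uIcc
  have e' := hg t right_mem_uIcc
  simp only [intervalIntegral.integral_same, add_zero] at key
  rw [← e, ← e'] at key
  rw [← key]
  apply intervalIntegral.integral_congr_ae
  filter_upwards [hf'.ae_hasDerivAt_integral, hg'.ae_hasDerivAt_integral] with u h1 h2 hu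
  have hu' := uIoc_subset_uIcc hu
  rw [((h1 hu' s left_mem_uIcc).const_add (f s)).deriv,
    ((h2 hu' s left_mem_uIcc).const_add (g s)).deriv, ← hf u hu', ← hg u hu']

/-- Lagrange's identity: pairing a solution of `z' = A z + g` with a solution `m` of the adjoint
equation `m' = - m A` leaves only the contribution of the inhomogeneity. -/
theorem dotProduct_sub_dotProduct_eq_integral {n : ℕ} {A : ℝ → Matrix (Fin n) (Fin n) ℝ}
    {m z g : ℝ → Fin n → ℝ} {s t : ℝ}
    (hA : ∀ i j, IntervalIntegrable (fun u => A u i j) volume s t)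
    (hg : ∀ k, IntervalIntegrable (fun u => g u k) volume s t)
    (hmc : ∀ k, ContinuousOn (fun u => m u k) (uIcc s t))
    (hzc : ∀ k, ContinuousOn (fun u => z u k) (uIcc s t))
    (hz : ∀ u ∈ uIcc s t, ∀ k, z u k = z s k + ∫ v in s..u, ((A v *ᵥ z v) k + g v k))
    (hm : ∀ u ∈ uIcc s t, ∀ k, m u k = m s k + ∫ v in s..u, -(m v ᵥ* A v) k) :
    m t ⬝ᵥ z t - m s ⬝ᵥ z s = ∫ u in s..t, m u ⬝ᵥ g u := by
  have hAz : ∀ k, IntervalIntegrable (fun v => (A v *ᵥ z v) k) volume s t := by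
    intro k
    have : (fun v => (A v *ᵥ z v) k) = ∑ j, fun v => A v k j * z v j := by
      ext v; simp [Matrix.mulVec, dotProduct]
    rw [this]
    exact IntervalIntegrable.sum _ fun j _ => (hA k j).mul_continuousOn (hzc j)
  have hmA : ∀ k, IntervalIntegrable (fun v => -(m v ᵥ* A v) k) volume s t := by
    intro k
    have : (fun v => (m v ᵥ* A v) k) = ∑ j, fun v => m v j * A v j k := by
      ext v; simp [Matrix.vecMul, dotProduct]
    have h2 : IntervalIntegrable (fun v => (m v ᵥ* A v) k) volume s t := by
      rw [this]
      exact IntervalIntegrable.sum _ fun j _ => (hA j k).continuousOn_mul (hmc j)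
    exact h2.neg
  have hzg : ∀ k, IntervalIntegrable (fun v => (A v *ᵥ z v) k + g v k) volume s t :=
    fun k => (hAz k).add (hg k)
  have key : ∀ k, m t k * z t k - m s k * z s k =
      ∫ u in s..t, (-(m u ᵥ* A u) k * z u k + m u k * ((A u *ᵥ z u) k + g u k)) := fun k =>
    mul_sub_mul_eq_integral_of_primitive (f := fun u => m u k) (g := fun u => z u k)
      (hmA k) (hzg k) (fun u hu => hm u hu k) (fun u hu => hz u hu k)
  simp only [dotProduct]
  rw [← Finset.sum_sub_distrib, Finset.sum_congr rfl fun k _ => key k,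
    ← intervalIntegral.integral_finsetSum]
  · refine intervalIntegral.integral_congr fun u _ => ?_
    have h := Matrix.dotProduct_mulVec (m u) (A u) (z u)
    simp only [dotProduct] at h
    simp only [mul_add, Finset.sum_add_distrib, h, neg_mul, Finset.sum_neg_distrib]
    ring
  · exact fun k _ => ((hmA k).mul_continuousOn (hzc k)).add ((hzg k).continuousOn_mul (hmc k))

variable {n : ℕ} {T : ℝ} {A : ℝ → Matrix (Fin n) (Fin n) ℝ}

theorem intervalIntegrable_of_memLp_top {f : ℝ → ℝ} (hf : MemLp f ∞ (volume.restrict (Icc 0 T)))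
    {s t : ℝ} (hs : s ∈ Icc 0 T) (ht : t ∈ Icc 0 T) : IntervalIntegrable f volume s t := by
  have h : IntegrableOn f (Icc 0 T) := hf.integrable (by simp)
  rw [intervalIntegrable_iff]
  exact h.mono_set (uIoc_subset_uIcc.trans (uIcc_subset_Icc hs ht))

theorem MatrixLInfty.neg_transpose (hA : MatrixLInfty T A) :
    MatrixLInfty T (fun u => -(A u)ᵀ) := fun i j => (hA j i).neg

theorem continuousOn_fundamentalMatrix_left (hA : MatrixLInfty T A) {s : ℝ} (hs : s ∈ Icc 0 T)
    (i j : Fin n) : ContinuousOn (fun t => fundamentalMatrix T A t s i j) (Icc 0 T) := by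
  have h := (isFundamentalMatrix_fundamentalMatrix hA).continuousOn s hs
  exact ((continuous_apply j).comp (continuous_apply i)).comp_continuousOn h

theorem intervalIntegrable_mul_fundamentalMatrix (hA : MatrixLInfty T A) {s u v : ℝ}
    (hs : s ∈ Icc 0 T) (hu : u ∈ Icc 0 T) (hv : v ∈ Icc 0 T) (i j : Fin n) :
    IntervalIntegrable (fun w => (A w * fundamentalMatrix T A w s) i j) volume u v := by
  have : (fun w => (A w * fundamentalMatrix T A w s) i j) =
      ∑ k, fun w => A w i k * fundamentalMatrix T A w s k j := by
    ext w; simp [Matrix.mul_apply]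
  rw [this]
  exact IntervalIntegrable.sum _ fun k _ =>
    (intervalIntegrable_of_memLp_top (hA i k) hu hv).mul_continuousOn
      ((continuousOn_fundamentalMatrix_left hA hs k j).mono (uIcc_subset_Icc hu hv))

theorem fundamentalMatrix_self (hA : MatrixLInfty T A) {s : ℝ} (hs : s ∈ Icc 0 T) :
    fundamentalMatrix T A s s = 1 := by
  ext i j
  simpa using (isFundamentalMatrix_fundamentalMatrix hA).equation s hs s hs i j

theorem fundamentalMatrix_eq_add_integral (hA : MatrixLInfty T A) {s u v : ℝ}
    (hs : s ∈ Icc 0 T) (hu : u ∈ Icc 0 T) (hv : v ∈ Icc 0 T) (i j : Fin n) :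
    fundamentalMatrix T A v s i j = fundamentalMatrix T A u s i j +
      ∫ w in u..v, (A w * fundamentalMatrix T A w s) i j := by
  have hF := isFundamentalMatrix_fundamentalMatrix hA
  rw [hF.equation s hs v hv, hF.equation s hs u hu, add_assoc,
    intervalIntegral.integral_add_adjacent_intervals
      (intervalIntegrable_mul_fundamentalMatrix hA hs hs hu i j)
      (intervalIntegrable_mul_fundamentalMatrix hA hs hu hv i j)]

/-- Variation of constants, written with the fundamental matrix of the adjoint equation. -/
theorem variation_of_constants_adjoint (hA : MatrixLInfty T A) {z g : ℝ → Fin n → ℝ} {s t : ℝ}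
    (hs : s ∈ Icc 0 T) (ht : t ∈ Icc 0 T)
    (hg : ∀ k, IntervalIntegrable (fun u => g u k) volume s t)
    (hzc : ∀ k, ContinuousOn (fun u => z u k) (uIcc s t))
    (hz : ∀ u ∈ uIcc s t, ∀ k, z u k = z s k + ∫ v in s..u, ((A v *ᵥ z v) k + g v k)) :
    z t = (fundamentalMatrix T (fun u => -(A u)ᵀ) s t)ᵀ *ᵥ z s +
      fun i => ∫ u in s..t, ((fundamentalMatrix T (fun u => -(A u)ᵀ) u t)ᵀ *ᵥ g u) i := by
  have hA' := hA.neg_transpose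
  have hsub : uIcc s t ⊆ Icc 0 T := uIcc_subset_Icc hs ht
  ext i
  set Ψ := fundamentalMatrix T (fun u => -(A u)ᵀ) with hΨ
  have key := dotProduct_sub_dotProduct_eq_integral (m := fun u k => Ψ u t k i) (z := z) (g := g)
    (fun i j => intervalIntegrable_of_memLp_top (hA i j) hs ht) hg
    (fun k => (continuousOn_fundamentalMatrix_left hA' ht k i).mono hsub) hzc hz (by
      intro u hu k
      have e := fundamentalMatrix_eq_add_integral hA' ht hs (hsub hu) k i
      refine e.trans ?_
      congr 1
      refine intervalIntegral.integral_congr fun v _ => ?_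
      simp only [Matrix.mul_apply, Matrix.vecMul, dotProduct, Matrix.neg_apply,
        Matrix.transpose_apply, neg_mul, Finset.sum_neg_distrib]
      congr 1
      exact Finset.sum_congr rfl fun l _ => mul_comm _ _)
  -- The adjoint solution starts at time `t` from the unit vector `e_i`, so it reads off `z t i`.
  have h1 : (fun k => Ψ t t k i) ⬝ᵥ z t = z t i := by
    have : (fun k => Ψ t t k i) = Pi.single i 1 := by
      ext k
      rw [hΨ, fundamentalMatrix_self hA' ht, Matrix.one_apply, Pi.single_apply]
    rw [this, single_one_dotProduct]
  simp only [h1] at key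
  have h2 : ∀ (v : ℝ) (w : Fin n → ℝ), (fun k => Ψ v t k i) ⬝ᵥ w = ((Ψ v t)ᵀ *ᵥ w) i :=
    fun v w => rfl
  simp only [h2] at key
  rw [Pi.add_apply, ← key]
  ring

/-- The rows of `Φ_A(t, ·)` solve the adjoint equation. -/
theorem fundamentalMatrix_eq_transpose (hA : MatrixLInfty T A) {s t : ℝ}
    (hs : s ∈ Icc 0 T) (ht : t ∈ Icc 0 T) :
    fundamentalMatrix T A t s = (fundamentalMatrix T (fun u => -(A u)ᵀ) s t)ᵀ := by
  have hsub : uIcc s t ⊆ Icc 0 T := uIcc_subset_Icc hs ht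
  ext i j
  have key := variation_of_constants_adjoint hA (z := fun u k => fundamentalMatrix T A u s k j)
    (g := fun _ _ => 0) hs ht (fun k => intervalIntegrable_const)
    (fun k => (continuousOn_fundamentalMatrix_left hA hs k j).mono hsub) (by
      intro u hu k
      simp only [add_zero]
      exact fundamentalMatrix_eq_add_integral hA hs hs (hsub hu) k j)
  have h := congrFun key i
  have h0 : (fun k => fundamentalMatrix T A s s k j) = Pi.single j 1 := by
    ext k
    rw [fundamentalMatrix_self hA hs, Matrix.one_apply, Pi.single_apply]
  simp only [h0, Matrix.mulVec_single_one, Pi.add_apply] at h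
  rw [h]
  have : (fun _ => 0 : Fin n → ℝ) = 0 := rfl
  simp [this, Matrix.mulVec_zero]

theorem continuousOn_fundamentalMatrix_right (hA : MatrixLInfty T A) {t : ℝ} (ht : t ∈ Icc 0 T)
    (i j : Fin n) : ContinuousOn (fun s => fundamentalMatrix T A t s i j) (Icc 0 T) := by
  refine (continuousOn_fundamentalMatrix_left hA.neg_transpose ht j i).congr fun s hs => ?_
  simp only [fundamentalMatrix_eq_transpose hA hs ht, Matrix.transpose_apply]

/-- Variation of constants for `z' = A z + g`, understood in integrated form. -/
theorem variation_of_constants (hA : MatrixLInfty T A) {z g : ℝ → Fin n → ℝ} {s t : ℝ}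
    (hs : s ∈ Icc 0 T) (ht : t ∈ Icc 0 T)
    (hg : ∀ k, IntervalIntegrable (fun u => g u k) volume s t)
    (hzc : ∀ k, ContinuousOn (fun u => z u k) (uIcc s t))
    (hz : ∀ u ∈ uIcc s t, ∀ k, z u k = z s k + ∫ v in s..u, ((A v *ᵥ z v) k + g v k)) :
    z t = fundamentalMatrix T A t s *ᵥ z s +
      fun i => ∫ u in s..t, (fundamentalMatrix T A t u *ᵥ g u) i := by
  rw [variation_of_constants_adjoint hA hs ht hg hzc hz, fundamentalMatrix_eq_transpose hA hs ht]
  congr 1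
  ext i
  refine intervalIntegral.integral_congr fun u hu => ?_
  simp only [fundamentalMatrix_eq_transpose hA (uIcc_subset_Icc hs ht hu) ht]

/-- The cocycle property: `Φ_A(·, s)` solves the equation with initial value `Φ_A(u, s)` at `u`. -/
theorem fundamentalMatrix_mul (hA : MatrixLInfty T A) {s u t : ℝ}
    (hs : s ∈ Icc 0 T) (hu : u ∈ Icc 0 T) (ht : t ∈ Icc 0 T) :
    fundamentalMatrix T A t u * fundamentalMatrix T A u s = fundamentalMatrix T A t s := by
  have hsub : uIcc u t ⊆ Icc 0 T := uIcc_subset_Icc hu ht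
  ext i j
  have key := variation_of_constants hA (z := fun v k => fundamentalMatrix T A v s k j)
    (g := fun _ _ => 0) hu ht (fun k => intervalIntegrable_const)
    (fun k => (continuousOn_fundamentalMatrix_left hA hs k j).mono hsub) (by
      intro v hv k
      simp only [add_zero]
      exact fundamentalMatrix_eq_add_integral hA hs hu (hsub hv) k j)
  have h := congrFun key i
  have h0 : (fun _ => 0 : Fin n → ℝ) = 0 := rfl
  simp only [Pi.add_apply, h0, Matrix.mulVec_zero, Pi.zero_apply,
    intervalIntegral.integral_zero, add_zero] at h
  exact h.symm

/-- The backward equation `∂_s Φ_A(t, s) = - Φ_A(t, s) A(s)` in integrated form. -/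
theorem fundamentalMatrix_eq_one_add_integral (hA : MatrixLInfty T A) {s t : ℝ}
    (hs : s ∈ Icc 0 T) (ht : t ∈ Icc 0 T) (i j : Fin n) :
    fundamentalMatrix T A t s i j = (1 : Matrix (Fin n) (Fin n) ℝ) i j +
      ∫ u in s..t, (fundamentalMatrix T A t u * A u) i j := by
  have hsub : uIcc s t ⊆ Icc 0 T := uIcc_subset_Icc hs ht
  have hF := isFundamentalMatrix_fundamentalMatrix hA.neg_transpose
  rw [fundamentalMatrix_eq_transpose hA hs ht, Matrix.transpose_apply, hF.equation t ht s hs,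
    intervalIntegral.integral_symm, ← intervalIntegral.integral_neg, ← Matrix.transpose_apply 1,
    Matrix.transpose_one]
  congr 1
  refine intervalIntegral.integral_congr fun u hu => ?_
  simp only [fundamentalMatrix_eq_transpose hA (hsub hu) ht, Matrix.mul_apply, Matrix.neg_apply,
    Matrix.transpose_apply, neg_mul, Finset.sum_neg_distrib, neg_neg]
  exact Finset.sum_congr rfl fun l _ => mul_comm _ _

end VariationOfConstants

/-! ### Wiener integrals of deterministic functions -/

section WienerIntegral

theorem eLpNorm_two_eq_of_integral_sq_eq {α β : Type*} {mα : MeasurableSpace α}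
    {mβ : MeasurableSpace β} {μ : Measure α} {ν : Measure β} {f : α → ℝ} {g : β → ℝ}
    (hf : MemLp f 2 μ) (hg : MemLp g 2 ν) (h : ∫ x, f x * f x ∂μ = ∫ y, g y * g y ∂ν) :
    eLpNorm f 2 μ = eLpNorm g 2 ν := by
  rw [hf.eLpNorm_eq_integral_rpow_norm (by norm_num) (by norm_num),
    hg.eLpNorm_eq_integral_rpow_norm (by norm_num) (by norm_num)]
  have e : ∀ x : ℝ, ‖x‖ ^ (2 : ℝ≥0∞).toReal = x * x := fun x => by
    rw [ENNReal.toReal_ofNat, Real.rpow_two, Real.norm_eq_abs, sq_abs, sq]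
  simp only [e, h]

theorem integral_indicator_Ioc_mul {a b c d : ℝ} (hab : a ≤ b) (hcd : c ≤ d) :
    ∫ s, (Ioc a b).indicator (fun _ => (1 : ℝ)) s * (Ioc c d).indicator (fun _ => (1 : ℝ)) s =
      min b d - min b c - min a d + min a c := by
  have e : (fun s => (Ioc a b).indicator (fun _ => (1 : ℝ)) s *
      (Ioc c d).indicator (fun _ => (1 : ℝ)) s) =
      (Ioc (max a c) (min b d)).indicator (fun _ => (1 : ℝ)) := by
    rw [← Ioc_inter_Ioc]
    ext s
    by_cases h1 : s ∈ Ioc a b <;> by_cases h2 : s ∈ Ioc c d <;> simp [h1, h2]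
  rw [e, integral_indicator measurableSet_Ioc, setIntegral_const, Real.volume_real_Ioc]
  simp only [smul_eq_mul, mul_one, max_def, min_def]
  split_ifs <;> linarith

variable {Ω : Type*} {mΩ : MeasurableSpace Ω} {P : Measure Ω} {ℱ : Filtration ℝ≥0 mΩ}
  {W : ℝ≥0 → Ω → ℝ} {n : ℕ}

theorem IsWienerProcess.memLp (hW : IsWienerProcess ℱ P W) (t : ℝ≥0) : MemLp (W t) 2 P :=
  (hW.isBrownian.isGaussianProcess.hasGaussianLaw_eval t).memLp_two

theorem IsWienerProcess.integral_mul [IsProbabilityMeasure P] (hW : IsWienerProcess ℱ P W)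
    (s t : ℝ≥0) :
    ∫ ω, W s ω * W t ω ∂P = min (s : ℝ) t := by
  have h := hW.isBrownian.covariance_eval s t
  rw [covariance_eq_sub (hW.memLp s) (hW.memLp t), hW.isBrownian.integral_eval, zero_mul,
    sub_zero] at h
  rw [← NNReal.coe_min, ← h]
  rfl

theorem IsWienerProcess.integral_sub_mul_sub [IsProbabilityMeasure P] (hW : IsWienerProcess ℱ P W)
    {a b c d : ℝ≥0}
    (hab : a ≤ b) (hcd : c ≤ d) :
    ∫ ω, (W b ω - W a ω) * (W d ω - W c ω) ∂P =
      ∫ s, (Ioc (a : ℝ) b).indicator (fun _ => (1 : ℝ)) s *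
        (Ioc (c : ℝ) d).indicator (fun _ => (1 : ℝ)) s := by
  rw [integral_indicator_Ioc_mul (NNReal.coe_le_coe.2 hab) (NNReal.coe_le_coe.2 hcd)]
  rw [DelayedSDE.integral_sub_mul_sub (hW.memLp b) (hW.memLp a) (hW.memLp d) (hW.memLp c)]
  simp only [hW.integral_mul]
  ring

/-- Increments after time `τ` are orthogonal to the square integrable `ℱ_τ`-measurable
variables, so replacing `W_u` by `W_{min(u, τ)}` does not change its correlation with them. -/
theorem IsWienerProcess.integral_mul_sub_min (hW : IsWienerProcess ℱ P W) {τ : ℝ≥0} {Z : Ω → ℝ}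
    (hZm : Measurable[ℱ τ] Z) (hZ : MemLp Z 2 P) (u : ℝ≥0) :
    ∫ ω, Z ω * W u ω ∂P = ∫ ω, Z ω * W (min u τ) ω ∂P := by
  rcases le_total u τ with h | h
  · rw [min_eq_left h]
  rw [min_eq_right h, ← sub_eq_zero, 
    ← integral_sub (integrable_mul_of_memLp_two hZ (hW.memLp u))
      (integrable_mul_of_memLp_two hZ (hW.memLp τ))]
  have hind : IndepFun (fun ω => W u ω - W τ ω) Z P := by
    rw [IndepFun_iff_Indep]
    exact indep_of_indep_of_le_right (hW.indep_increments τ u h) hZm.comap_le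
  have hm : MemLp (fun ω => W u ω - W τ ω) 2 P := (hW.memLp u).sub (hW.memLp τ)
  have h0 : ∫ ω, (W u ω - W τ ω) ∂P = 0 := by
    rw [integral_sub (hW.isBrownian.integrable_eval u) (hW.isBrownian.integrable_eval τ),
      hW.isBrownian.integral_eval, hW.isBrownian.integral_eval, sub_zero]
  have := hind.integral_fun_mul_eq_mul_integral hm.1 hZ.1
  rw [h0, zero_mul] at this
  rw [← this]
  congr 1
  ext ω
  ring

namespace StepFun

theorem toFun_apply (φ : StepFun n) (s : ℝ) (j : Fin n) :
    φ.toFun s j = ∑ i, (Ioc (φ.l i : ℝ) (φ.r i : ℝ)).indicator (fun _ => (1 : ℝ)) s * φ.c i j := by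
  rw [toFun, Finset.sum_apply]
  refine Finset.sum_congr rfl fun i _ => ?_
  by_cases h : s ∈ Ioc (φ.l i : ℝ) (φ.r i : ℝ)
  · simp [indicator_of_mem h]
  · simp [indicator_of_notMem h]

theorem integral_apply (φ : StepFun n) (W : ℝ≥0 → Ω → ℝ) (ω : Ω) (j : Fin n) :
    φ.integral W ω j = ∑ i, (W (φ.r i) ω - W (φ.l i) ω) * φ.c i j := by
  simp [integral, Finset.sum_apply]

theorem memLp_toFun (φ : StepFun n) (j : Fin n) :
    MemLp (fun s => φ.toFun s j) 2 volume := by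
  simp only [toFun_apply]
  refine memLp_finsetSum _ fun i _ => MemLp.mul_const ?_ _
  exact memLp_indicator_const 2 measurableSet_Ioc 1 (Or.inr (by simp))

theorem memLp_integral (hW : IsWienerProcess ℱ P W) (φ : StepFun n) (j : Fin n) :
    MemLp (fun ω => φ.integral W ω j) 2 P := by
  simp only [integral_apply]
  exact memLp_finsetSum _ fun i _ => MemLp.mul_const ((hW.memLp _).sub (hW.memLp _)) _

theorem integral_mul_integral [IsProbabilityMeasure P] (hW : IsWienerProcess ℱ P W)
    (φ ψ : StepFun n) (i j : Fin n) :
    ∫ ω, φ.integral W ω i * ψ.integral W ω j ∂P = ∫ s, φ.toFun s i * ψ.toFun s j := by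
  simp only [integral_apply, toFun_apply, Finset.sum_mul_sum]
  have hw : ∀ u v, MemLp (fun ω => W u ω - W v ω) 2 P := fun u v => (hW.memLp u).sub (hW.memLp v)
  have hs : ∀ a b : ℝ, MemLp ((Ioc a b).indicator (fun _ => (1 : ℝ))) 2 volume := fun a b =>
    memLp_indicator_const 2 measurableSet_Ioc 1 (Or.inr (by simp))
  have iw : ∀ k l, Integrable (fun ω => (W (φ.r k) ω - W (φ.l k) ω) * φ.c k i *
      ((W (ψ.r l) ω - W (ψ.l l) ω) * ψ.c l j)) P := fun k l =>
    integrable_mul_of_memLp_two ((hw _ _).mul_const _) ((hw _ _).mul_const _)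
  have is : ∀ k l, Integrable (fun s => (Ioc (φ.l k : ℝ) (φ.r k)).indicator (fun _ => 1) s *
      φ.c k i * ((Ioc (ψ.l l : ℝ) (ψ.r l)).indicator (fun _ => 1) s * ψ.c l j)) volume :=
    fun k l => integrable_mul_of_memLp_two ((hs _ _).mul_const _) ((hs _ _).mul_const _)
  rw [integral_finsetSum _ fun k _ => integrable_finsetSum _ fun l _ => iw k l,
    integral_finsetSum _ fun k _ => integrable_finsetSum _ fun l _ => is k l]
  refine Finset.sum_congr rfl fun k _ => ?_
  rw [integral_finsetSum _ fun l _ => iw k l, integral_finsetSum _ fun l _ => is k l]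
  refine Finset.sum_congr rfl fun l _ => ?_
  simp only [mul_mul_mul_comm _ (φ.c k i)]
  rw [integral_mul_const, integral_mul_const,
    hW.integral_sub_mul_sub (φ.l_le_r k) (ψ.l_le_r l)]

/-- The restriction of a step function to times up to `τ`. -/
noncomputable def truncate (φ : StepFun n) (τ : ℝ≥0) : StepFun n where
  N := φ.N
  l i := min (φ.l i) τ
  r i := min (φ.r i) τ
  c := φ.c
  l_le_r i := min_le_min_right τ (φ.l_le_r i)

theorem toFun_truncate (φ : StepFun n) (τ : ℝ≥0) (s : ℝ) (j : Fin n) :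
    (φ.truncate τ).toFun s j = (Iic (τ : ℝ)).indicator (fun s => φ.toFun s j) s := by
  have key : ∀ i, Ioc (((φ.truncate τ).l i : ℝ≥0) : ℝ) (((φ.truncate τ).r i : ℝ≥0) : ℝ) =
      Ioc (φ.l i : ℝ) (φ.r i : ℝ) ∩ Iic (τ : ℝ) := by
    intro i
    ext x
    simp only [truncate, NNReal.coe_min, mem_Ioc, mem_inter_iff, mem_Iic, min_lt_iff, le_min_iff]
    grind
  rw [toFun_apply]
  by_cases h : s ∈ Iic (τ : ℝ)
  · rw [indicator_of_mem h, toFun_apply]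
    refine Finset.sum_congr rfl fun i _ => ?_
    rw [key, inter_comm, ← indicator_indicator, indicator_of_mem h]
    rfl
  · rw [indicator_of_notMem h]
    refine Finset.sum_eq_zero fun i _ => ?_
    rw [key, inter_comm, ← indicator_indicator, indicator_of_notMem h, zero_mul]

theorem integral_mul_integral_truncate (hW : IsWienerProcess ℱ P W) (φ : StepFun n) {τ : ℝ≥0}
    {Z : Ω → ℝ} (hZm : Measurable[ℱ τ] Z) (hZ : MemLp Z 2 P) (j : Fin n) :
    ∫ ω, Z ω * φ.integral W ω j ∂P = ∫ ω, Z ω * (φ.truncate τ).integral W ω j ∂P := by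
  simp only [integral_apply, Finset.mul_sum]
  have hw : ∀ u v, MemLp (fun ω => W u ω - W v ω) 2 P := fun u v => (hW.memLp u).sub (hW.memLp v)
  have i : ∀ u, Integrable (fun ω => Z ω * W u ω) P := fun u =>
    integrable_mul_of_memLp_two hZ (hW.memLp u)
  have iw : ∀ u v (q : ℝ), Integrable (fun ω => Z ω * ((W u ω - W v ω) * q)) P := fun u v q =>
    integrable_mul_of_memLp_two hZ ((hw u v).mul_const q)
  rw [integral_finsetSum _ fun k _ => iw _ _ _, integral_finsetSum _ fun k _ => iw _ _ _]
  refine Finset.sum_congr rfl fun k _ => ?_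
  simp only [← mul_assoc, mul_sub]
  rw [integral_mul_const, integral_mul_const, integral_sub (i _) (i _), integral_sub (i _) (i _),
    hW.integral_mul_sub_min hZm hZ (φ.r k), hW.integral_mul_sub_min hZm hZ (φ.l k)]
  rfl

end StepFun

variable {f g : ℝ → Fin n → ℝ} {a b c d : ℝ} {I J : Ω → Fin n → ℝ}

/-- A Wiener integral over `(a, b]`, seen coordinatewise as an integral over the whole line. -/
theorem IsWienerIntegral.exists_tendsto (hI : IsWienerIntegral P W f a b I) :
    ∃ φ : ℕ → StepFun n, ∀ j,
      Tendsto (fun k => eLpNorm ((fun s => (φ k).toFun s j) - (Ioc a b).indicator (fun s => f s j))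
        2 volume) atTop (𝓝 0) ∧
      Tendsto (fun k => eLpNorm ((fun ω => (φ k).integral W ω j) - fun ω => I ω j) 2 P)
        atTop (𝓝 0) := by
  obtain ⟨-, φ, hs, h1, h2⟩ := hI
  refine ⟨φ, fun j => ⟨?_, ?_⟩⟩
  · refine tendsto_of_tendsto_of_tendsto_of_le_of_le tendsto_const_nhds h1 (fun _ => zero_le)
      fun k => ?_
    have e : ((fun s => (φ k).toFun s j) - (Ioc a b).indicator (fun s => f s j)) =
        (Ioc a b).indicator (fun s => (φ k).toFun s j - f s j) := by
      ext s
      by_cases h : s ∈ Ioc a b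
      · simp [indicator_of_mem h]
      · have : (φ k).toFun s j = 0 := by
          rw [StepFun.toFun_apply]
          refine Finset.sum_eq_zero fun i _ => ?_
          rw [indicator_of_notMem, zero_mul]
          exact fun h' => h ⟨(hs k i).1.trans_lt h'.1, h'.2.trans (hs k i).2⟩
        simp [indicator_of_notMem h, this]
    simp only [e]
    rw [eLpNorm_indicator_eq_eLpNorm_restrict measurableSet_Ioc]
    exact eLpNorm_mono fun s => norm_le_pi_norm ((φ k).toFun s - f s) j
  · refine tendsto_of_tendsto_of_tendsto_of_le_of_le tendsto_const_nhds h2 (fun _ => zero_le)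
      fun k => ?_
    exact eLpNorm_mono fun ω => norm_le_pi_norm ((φ k).integral W ω - I ω) j

theorem IsWienerIntegral.memLp_apply (hI : IsWienerIntegral P W f a b I) (j : Fin n) :
    MemLp (fun ω => I ω j) 2 P := hI.1.eval j

variable [IsProbabilityMeasure P]

/-- The Itô isometry in polarized form. -/
theorem IsWienerIntegral.integral_mul (hW : IsWienerProcess ℱ P W)
    (hI : IsWienerIntegral P W f a b I) (hJ : IsWienerIntegral P W g c d J) (i j : Fin n)
    (hf : MemLp ((Ioc a b).indicator fun s => f s i) 2 volume)
    (hg : MemLp ((Ioc c d).indicator fun s => g s j) 2 volume) :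
    ∫ ω, I ω i * J ω j ∂P =
      ∫ s, (Ioc a b).indicator (fun s => f s i) s * (Ioc c d).indicator (fun s => g s j) s := by
  obtain ⟨φ, hφ⟩ := hI.exists_tendsto
  obtain ⟨ψ, hψ⟩ := hJ.exists_tendsto
  have l1 := tendsto_integral_mul_of_tendsto_eLpNorm
    (fun k => (φ k).memLp_integral hW i) (hI.memLp_apply i)
    (fun k => (ψ k).memLp_integral hW j) (hJ.memLp_apply j) (hφ i).2 (hψ j).2
  have l2 := tendsto_integral_mul_of_tendsto_eLpNorm
    (fun k => (φ k).memLp_toFun i) hf (fun k => (ψ k).memLp_toFun j) hg (hφ i).1 (hψ j).1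
  simp only [StepFun.integral_mul_integral hW] at l1
  exact tendsto_nhds_unique l1 l2

/-- The same isometry when one of the factors is an elementary integral. -/
theorem IsWienerIntegral.integral_step_mul (hW : IsWienerProcess ℱ P W)
    (hJ : IsWienerIntegral P W g c d J) (φ : StepFun n) (i j : Fin n)
    (hg : MemLp ((Ioc c d).indicator fun s => g s j) 2 volume) :
    ∫ ω, φ.integral W ω i * J ω j ∂P =
      ∫ s, φ.toFun s i * (Ioc c d).indicator (fun s => g s j) s := by
  obtain ⟨ψ, hψ⟩ := hJ.exists_tendsto
  have l1 := tendsto_integral_mul_of_tendsto_eLpNorm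
    (fun _ : ℕ => φ.memLp_integral hW i) (φ.memLp_integral hW i)
    (fun k => (ψ k).memLp_integral hW j) (hJ.memLp_apply j) (by simp) (hψ j).2
  have l2 := tendsto_integral_mul_of_tendsto_eLpNorm
    (fun _ : ℕ => φ.memLp_toFun i) (φ.memLp_toFun i)
    (fun k => (ψ k).memLp_toFun j) hg (by simp) (hψ j).1
  simp only [StepFun.integral_mul_integral hW] at l1
  exact tendsto_nhds_unique l1 l2

/-- A Wiener integral and its value at the earlier time `τ` have the same correlation with every
square integrable `ℱ_τ`-measurable variable. -/
theorem IsWienerIntegral.integral_mul_eq_of_le (hW : IsWienerProcess ℱ P W) {τ : ℝ≥0} {u : ℝ}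
    (hτu : (τ : ℝ) ≤ u) (hI : IsWienerIntegral P W f 0 u I) (hJ : IsWienerIntegral P W f 0 τ J)
    (j : Fin n) (hf : MemLp ((Ioc 0 u).indicator fun s => f s j) 2 volume)
    {Z : Ω → ℝ} (hZm : Measurable[ℱ τ] Z) (hZ : MemLp Z 2 P) :
    ∫ ω, Z ω * I ω j ∂P = ∫ ω, Z ω * J ω j ∂P := by
  obtain ⟨φ, hφ⟩ := hI.exists_tendsto
  have hind : (Iic (τ : ℝ)).indicator ((Ioc 0 u).indicator fun s => f s j) =
      (Ioc 0 (τ : ℝ)).indicator fun s => f s j := by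
    rw [indicator_indicator]
    congr 1
    ext x
    simp only [mem_inter_iff, mem_Iic, mem_Ioc]
    grind
  have hf' : MemLp ((Ioc 0 (τ : ℝ)).indicator fun s => f s j) 2 volume :=
    hind ▸ hf.indicator measurableSet_Iic
  -- The truncated approximations of `I` converge to `J`, by the isometry.
  have htrunc : Tendsto (fun k => eLpNorm ((fun ω => ((φ k).truncate τ).integral W ω j) -
      fun ω => J ω j) 2 P) atTop (𝓝 0) := by
    refine tendsto_of_tendsto_of_tendsto_of_le_of_le tendsto_const_nhds (hφ j).1
      (fun _ => zero_le) fun k => ?_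
    have m1 := ((φ k).truncate τ).memLp_integral hW j
    have m2 := hJ.memLp_apply j
    have m3 := ((φ k).truncate τ).memLp_toFun j
    have e : eLpNorm ((fun ω => ((φ k).truncate τ).integral W ω j) - fun ω => J ω j) 2 P =
        eLpNorm ((fun s => ((φ k).truncate τ).toFun s j) -
          (Ioc 0 (τ : ℝ)).indicator fun s => f s j) 2 volume := by
      refine eLpNorm_two_eq_of_integral_sq_eq (m1.sub m2) (m3.sub hf') ?_
      refine (integral_sub_mul_sub m1 m2 m1 m2).trans
        (Eq.trans ?_ (integral_sub_mul_sub m3 hf' m3 hf').symm)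
      have c : ∫ ω, J ω j * ((φ k).truncate τ).integral W ω j ∂P =
          ∫ s, (Ioc 0 (τ : ℝ)).indicator (fun s => f s j) s * ((φ k).truncate τ).toFun s j := by
        simpa only [mul_comm] using hJ.integral_step_mul hW ((φ k).truncate τ) j j hf'
      rw [StepFun.integral_mul_integral hW, hJ.integral_step_mul hW _ j j hf', c,
        hJ.integral_mul hW hJ j j hf' hf']
    simp only [e]
    have e2 : ((fun s => ((φ k).truncate τ).toFun s j) - (Ioc 0 (τ : ℝ)).indicator fun s => f s j) =
        (Iic (τ : ℝ)).indicator
          ((fun s => (φ k).toFun s j) - (Ioc 0 u).indicator fun s => f s j) := by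
      rw [indicator_sub', hind]
      congr 1
      ext s
      exact StepFun.toFun_truncate _ _ _ _
    rw [e2]
    exact eLpNorm_indicator_le _
  have l1 := tendsto_integral_mul_of_tendsto_eLpNorm (fun _ : ℕ => hZ) hZ
    (fun k => (φ k).memLp_integral hW j) (hI.memLp_apply j) (by simp) (hφ j).2
  have l2 := tendsto_integral_mul_of_tendsto_eLpNorm (fun _ : ℕ => hZ) hZ
    (fun k => ((φ k).truncate τ).memLp_integral hW j) (hJ.memLp_apply j) (by simp) htrunc
  exact tendsto_nhds_unique
    (l1.congr fun k => StepFun.integral_mul_integral_truncate hW (φ k) hZm hZ j) l2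

end WienerIntegral

/-! ### Terminal value of a linear system driven by a process -/

section TerminalValue

/-- `F(t) + ∫ K(u) F(u) ν(du)`. For `K(u) = Φ_A(t,u) A(u)` and `ν` the Lebesgue measure on `(τ, t]`
this is the terminal value at `t` of the solution of `dz = A z du + dF`, `z(τ) = 0`, when
`F(τ) = 0`. -/
noncomputable def terminalValue {Ω : Type*} {n : ℕ} (ν : Measure ℝ)
    (K : ℝ → Matrix (Fin n) (Fin n) ℝ) (t : ℝ) (F : ℝ → Ω → Fin n → ℝ) (ω : Ω) : Fin n → ℝ :=
  fun i => F t ω i + ∫ u, (K u *ᵥ F u ω) i ∂ν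

variable {Ω Ω' : Type*} {mΩ : MeasurableSpace Ω} {mΩ' : MeasurableSpace Ω'} {P : Measure Ω}
  {P' : Measure Ω'} [IsFiniteMeasure P] [IsFiniteMeasure P'] {n : ℕ} {ν : Measure ℝ}
  {K : ℝ → Matrix (Fin n) (Fin n) ℝ} {t : ℝ} {F : ℝ → Ω → Fin n → ℝ} {G : ℝ → Ω' → Fin n → ℝ}

theorem memLp_prod_mulVec {p q : ℕ} {M : ℝ → Matrix (Fin p) (Fin q) ℝ} {H : ℝ → Ω → Fin q → ℝ}
    (hM : ∀ i j, MemLp (fun u => M u i j) ∞ ν)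
    (hH : ∀ j, MemLp (fun x : ℝ × Ω => H x.1 x.2 j) 2 (ν.prod P)) (i : Fin p) :
    MemLp (fun x : ℝ × Ω => (M x.1 *ᵥ H x.1 x.2) i) 2 (ν.prod P) := by
  simp only [Matrix.mulVec, dotProduct]
  exact memLp_finsetSum _ fun j _ => 
    memLp_prod_bdd_mul (F := fun u ω => H u ω j) (hM i j) (hH j)

variable [IsFiniteMeasure ν]

theorem memLp_terminalValue (hK : ∀ i j, MemLp (fun u => K u i j) ∞ ν)
    (hF : ∀ j, MemLp (fun x : ℝ × Ω => F x.1 x.2 j) 2 (ν.prod P))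
    (hFt : ∀ j, MemLp (fun ω => F t ω j) 2 P) (i : Fin n) :
    MemLp (fun ω => terminalValue ν K t F ω i) 2 P :=
  (hFt i).add (memLp_integral_of_memLp_prod (memLp_prod_mulVec hK hF i))

theorem integral_mul_integral_mulVec {p q : ℕ} {M : ℝ → Matrix (Fin p) (Fin q) ℝ}
    {H : ℝ → Ω → Fin q → ℝ} (hM : ∀ i j, MemLp (fun u => M u i j) ∞ ν)
    (hH : ∀ j, MemLp (fun x : ℝ × Ω => H x.1 x.2 j) 2 (ν.prod P)) {Z : Ω → ℝ} (hZ : MemLp Z 2 P)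
    (i : Fin p) :
    ∫ ω, Z ω * ∫ u, (M u *ᵥ H u ω) i ∂ν ∂P =
      ∫ u, (M u *ᵥ fun j => ∫ ω, Z ω * H u ω j ∂P) i ∂ν := by
  rw [integral_mul_integral_comm hZ (memLp_prod_mulVec hM hH i)]
  refine integral_congr_ae ?_
  filter_upwards [ae_all_iff.2 fun j => 
    ae_memLp_of_memLp_prod (F := fun u ω => H u ω j) (hH j)] with u hu
  simp only [Matrix.mulVec, dotProduct, Finset.mul_sum, mul_left_comm (Z _)]
  rw [integral_finsetSum _ fun j _ => (integrable_mul_of_memLp_two hZ (hu j)).const_mul _]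
  simp only [integral_const_mul]

theorem integral_mul_terminalValue (hK : ∀ i j, MemLp (fun u => K u i j) ∞ ν)
    (hF : ∀ j, MemLp (fun x : ℝ × Ω => F x.1 x.2 j) 2 (ν.prod P))
    (hFt : ∀ j, MemLp (fun ω => F t ω j) 2 P) {Z : Ω → ℝ} (hZ : MemLp Z 2 P) (i : Fin n) :
    ∫ ω, Z ω * terminalValue ν K t F ω i ∂P =
      ∫ ω, Z ω * F t ω i ∂P + ∫ u, (K u *ᵥ fun j => ∫ ω, Z ω * F u ω j ∂P) i ∂ν := by
  rw [← integral_mul_integral_mulVec hK hF hZ i, ← integral_add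
    (integrable_mul_of_memLp_two hZ (hFt i))
    (integrable_mul_of_memLp_two hZ (memLp_integral_of_memLp_prod (memLp_prod_mulVec hK hF i)))]
  simp only [terminalValue, mul_add]

/-- Terminal values depend on the driving process only through its second moments: processes on
different spaces with the same covariance function have terminal values with the same
covariance. -/
theorem integral_terminalValue_mul_congr {S : Set ℝ} (hS : ∀ᵐ u ∂ν, u ∈ S) (htS : t ∈ S)
    (hK : ∀ i j, MemLp (fun u => K u i j) ∞ ν)
    (hF : ∀ j, MemLp (fun x : ℝ × Ω => F x.1 x.2 j) 2 (ν.prod P))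
    (hFS : ∀ u ∈ S, ∀ j, MemLp (fun ω => F u ω j) 2 P)
    (hG : ∀ j, MemLp (fun x : ℝ × Ω' => G x.1 x.2 j) 2 (ν.prod P'))
    (hGS : ∀ u ∈ S, ∀ j, MemLp (fun ω => G u ω j) 2 P')
    (h : ∀ u ∈ S, ∀ v ∈ S, ∀ a b,
      ∫ ω, F u ω a * F v ω b ∂P = ∫ ω, G u ω a * G v ω b ∂P') (i j : Fin n) :
    ∫ ω, terminalValue ν K t F ω i * terminalValue ν K t F ω j ∂P =
      ∫ ω, terminalValue ν K t G ω i * terminalValue ν K t G ω j ∂P' := by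
  -- One factor at a time: first against the values of the process, then against the functional.
  have h1 : ∀ v ∈ S, ∀ b, ∫ ω, terminalValue ν K t F ω i * F v ω b ∂P =
      ∫ ω, terminalValue ν K t G ω i * G v ω b ∂P' := by
    intro v hv b
    simp only [mul_comm (terminalValue _ _ _ _ _ _)]
    rw [integral_mul_terminalValue hK hF (hFS t htS) (hFS v hv b),
      integral_mul_terminalValue hK hG (hGS t htS) (hGS v hv b), h v hv t htS]
    congr 1
    refine integral_congr_ae ?_
    filter_upwards [hS] with u hu
    simp only [h v hv u hu]
  rw [integral_mul_terminalValue hK hF (hFS t htS) (memLp_terminalValue hK hF (hFS t htS) i),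
    integral_mul_terminalValue hK hG (hGS t htS) (memLp_terminalValue hK hG (hGS t htS) i),
    h1 t htS]
  congr 1
  refine integral_congr_ae ?_
  filter_upwards [hS] with u hu
  simp only [h1 u hu]

end TerminalValue

/-! ### The accumulated noise -/

section Noise

theorem memLp_top_of_continuousOn_Icc {f : ℝ → ℝ} {T : ℝ} (hf : ContinuousOn f (Icc 0 T)) :
    MemLp f ∞ (volume.restrict (Icc 0 T)) := by
  obtain ⟨C, hC⟩ := isCompact_Icc.exists_bound_of_continuousOn hf
  refine memLp_top_of_bound (hf.aestronglyMeasurable measurableSet_Icc) C ?_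
  filter_upwards [ae_restrict_mem measurableSet_Icc] with u hu using hC u hu

theorem memLp_top_fundamentalMatrix_mul {n p : ℕ} {T : ℝ} {A : ℝ → Matrix (Fin n) (Fin n) ℝ}
    {M : ℝ → Matrix (Fin n) (Fin p) ℝ} (hA : MatrixLInfty T A) (hM : MatrixLInfty T M) {t : ℝ}
    (ht : t ∈ Icc 0 T) : MatrixLInfty T (fun u => fundamentalMatrix T A t u * M u) := by
  intro i j
  simp only [Matrix.mul_apply]
  exact memLp_finsetSum _ fun k _ =>
    (hM k j).mul (memLp_top_of_continuousOn_Icc (continuousOn_fundamentalMatrix_right hA ht i k))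

theorem restrict_Ioc_le_restrict_Icc {τ t T : ℝ} (hτ : 0 ≤ τ) (ht : t ≤ T) :
    (volume : Measure ℝ).restrict (Ioc τ t) ≤ volume.restrict (Icc 0 T) :=
  Measure.restrict_mono_set _ fun _ hx => ⟨hτ.trans hx.1.le, hx.2.trans ht⟩

theorem MatrixLInfty.memLp_restrict_Ioc {p q : ℕ} {T : ℝ} {M : ℝ → Matrix (Fin p) (Fin q) ℝ}
    (hM : MatrixLInfty T M) {τ t : ℝ} (hτ : 0 ≤ τ) (ht : t ≤ T) (i : Fin p) (j : Fin q) :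
    MemLp (fun u => M u i j) ∞ (volume.restrict (Ioc τ t)) :=
  (hM i j).mono_measure (restrict_Ioc_le_restrict_Icc hτ ht)

variable {Ω : Type*} {mΩ : MeasurableSpace Ω} {P : Measure Ω}
  {ℱ : Filtration ℝ≥0 mΩ} {W : ℝ≥0 → Ω → ℝ} {n : ℕ} {T : ℝ} {σ : ℝ → Fin n → ℝ}
  {J : ℝ → Ω → Fin n → ℝ}

theorem memLp_prod_restrict_Ioc {F : ℝ → Ω → ℝ} [SFinite P]
    (hF : MemLp (fun x : ℝ × Ω => F x.1 x.2) 2 ((volume.restrict (Icc 0 T)).prod P))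
    {τ t : ℝ} (hτ : 0 ≤ τ) (ht : t ≤ T) :
    MemLp (fun x : ℝ × Ω => F x.1 x.2) 2 ((volume.restrict (Ioc τ t)).prod P) :=
  hF.mono_measure (Measure.prod_mono (restrict_Ioc_le_restrict_Icc hτ ht) le_rfl)

/-- `J` is a version with continuous paths of the process `u ↦ ∫_0^u σ dW`, `u ∈ [0,T]`. -/
structure IsContinuousWienerIntegral (P : Measure Ω) (W : ℝ≥0 → Ω → ℝ) (T : ℝ)
    (σ : ℝ → Fin n → ℝ) (J : ℝ → Ω → Fin n → ℝ) : Prop where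
  version : ∀ u ∈ Icc 0 T, ∃ I, IsWienerIntegral P W σ 0 u I ∧ J u =ᵐ[P] I
  continuousOn : ∀ᵐ ω ∂P, ∀ k, ContinuousOn (fun u => J u ω k) (Icc 0 T)

theorem VectorLInfty.memLp_indicator (hσ : VectorLInfty T σ) {u : ℝ} (hu : u ≤ T)
    (a : Fin n) : MemLp ((Ioc 0 u).indicator fun s => σ s a) 2 volume := by
  rw [memLp_indicator_iff_restrict measurableSet_Ioc]
  exact ((hσ.eval a).mono_exponent le_top).mono_measure (restrict_Ioc_le_restrict_Icc le_rfl hu)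

namespace IsContinuousWienerIntegral

theorem memLp (hJ : IsContinuousWienerIntegral P W T σ J) {u : ℝ} (hu : u ∈ Icc 0 T)
    (a : Fin n) : MemLp (fun ω => J u ω a) 2 P := by
  obtain ⟨I, hI, e⟩ := hJ.version u hu
  refine (hI.memLp_apply a).ae_eq ?_
  filter_upwards [e] with ω hω
  rw [hω]

variable [IsProbabilityMeasure P]

theorem integral_mul (hW : IsWienerProcess ℱ P W) (hσ : VectorLInfty T σ)
    (hJ : IsContinuousWienerIntegral P W T σ J) {u v : ℝ} (hu : u ∈ Icc 0 T) (hv : v ∈ Icc 0 T)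
    (a b : Fin n) :
    ∫ ω, J u ω a * J v ω b ∂P = ∫ s, (Ioc 0 u).indicator (fun s => σ s a) s *
      (Ioc 0 v).indicator (fun s => σ s b) s := by
  obtain ⟨I, hI, e⟩ := hJ.version u hu
  obtain ⟨I', hI', e'⟩ := hJ.version v hv
  rw [← hI.integral_mul hW hI' a b (hσ.memLp_indicator hu.2 a) (hσ.memLp_indicator hv.2 b)]
  refine integral_congr_ae ?_
  filter_upwards [e, e'] with ω hω hω'
  rw [hω, hω']

theorem integral_mul_eq_of_le (hW : IsWienerProcess ℱ P W) (hσ : VectorLInfty T σ)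
    (hJ : IsContinuousWienerIntegral P W T σ J) {τ : ℝ≥0} {u : ℝ} (hτu : (τ : ℝ) ≤ u)
    (hu : u ∈ Icc 0 T) (a : Fin n) {Z : Ω → ℝ} (hZm : Measurable[ℱ τ] Z) (hZ : MemLp Z 2 P) :
    ∫ ω, Z ω * J u ω a ∂P = ∫ ω, Z ω * J τ ω a ∂P := by
  obtain ⟨I, hI, e⟩ := hJ.version u hu
  obtain ⟨I', hI', e'⟩ := hJ.version τ ⟨τ.2, hτu.trans hu.2⟩
  have h := hI.integral_mul_eq_of_le hW hτu hI' a (hσ.memLp_indicator hu.2 a) hZm hZ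
  have h1 : ∫ ω, Z ω * J u ω a ∂P = ∫ ω, Z ω * I ω a ∂P := by
    refine integral_congr_ae ?_
    filter_upwards [e] with ω hω
    rw [hω]
  have h2 : ∫ ω, Z ω * J τ ω a ∂P = ∫ ω, Z ω * I' ω a ∂P := by
    refine integral_congr_ae ?_
    filter_upwards [e'] with ω hω
    rw [hω]
  rw [h1, h2, h]

theorem memLp_prod (hW : IsWienerProcess ℱ P W) (hσ : VectorLInfty T σ)
    (hJ : IsContinuousWienerIntegral P W T σ J) (a : Fin n) :
    MemLp (fun x : ℝ × Ω => J x.1 x.2 a) 2 ((volume.restrict (Icc 0 T)).prod P) := by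
  refine memLp_prod_of_integral_sq_le (F := fun u ω => J u ω a)
    (C := ∫ s, (Ioc 0 T).indicator (fun s => σ s a) s * (Ioc 0 T).indicator (fun s => σ s a) s)
    (aestronglyMeasurable_prod_of_continuousOn (fun u hu => (hJ.memLp hu a).1) ?_) ?_ ?_
  · filter_upwards [hJ.continuousOn] with ω hω using hω a
  · filter_upwards [ae_restrict_mem measurableSet_Icc] with u hu using hJ.memLp hu a
  · filter_upwards [ae_restrict_mem measurableSet_Icc] with u hu
    rw [hJ.integral_mul hW hσ hu hu]
    have m1 := hσ.memLp_indicator hu.2 a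
    have m2 := hσ.memLp_indicator le_rfl a
    refine integral_mono (integrable_mul_of_memLp_two m1 m1) (integrable_mul_of_memLp_two m2 m2)
      fun s => ?_
    by_cases h : s ∈ Ioc 0 u
    · have h' : s ∈ Ioc 0 T := ⟨h.1, h.2.trans hu.2⟩
      simp only [indicator_of_mem h, indicator_of_mem h', le_refl]
    · simp only [indicator_of_notMem h, mul_zero]
      exact mul_self_nonneg _

variable {A : ℝ → Matrix (Fin n) (Fin n) ℝ} {τ : ℝ≥0} {t : ℝ}

theorem memLp_prod_sub (hW : IsWienerProcess ℱ P W) (hσ : VectorLInfty T σ)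
    (hJ : IsContinuousWienerIntegral P W T σ J) (hτt : (τ : ℝ) ≤ t) (ht : t ≤ T) (a : Fin n) :
    MemLp (fun x : ℝ × Ω => (J x.1 x.2 - J τ x.2) a) 2 ((volume.restrict (Ioc (τ : ℝ) t)).prod P) :=
  (memLp_prod_restrict_Ioc (F := fun u ω => J u ω a) (hJ.memLp_prod hW hσ a) τ.2 ht).sub
    ((hJ.memLp ⟨τ.2, hτt.trans ht⟩ a).comp_snd _)

theorem memLp_terminalValue (hW : IsWienerProcess ℱ P W) (hA : MatrixLInfty T A)
    (hσ : VectorLInfty T σ) (hJ : IsContinuousWienerIntegral P W T σ J) (hτt : (τ : ℝ) ≤ t)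
    (ht : t ≤ T) (i : Fin n) :
    MemLp (fun ω => terminalValue (volume.restrict (Ioc (τ : ℝ) t))
      (fun u => fundamentalMatrix T A t u * A u) t (fun u ω => J u ω - J τ ω) ω i) 2 P := by
  have htm : t ∈ Icc 0 T := ⟨τ.2.trans hτt, ht⟩
  exact DelayedSDE.memLp_terminalValue
    ((memLp_top_fundamentalMatrix_mul hA hA htm).memLp_restrict_Ioc τ.2 ht)
    (hJ.memLp_prod_sub hW hσ hτt ht)
    (fun j => (hJ.memLp htm j).sub (hJ.memLp ⟨τ.2, hτt.trans ht⟩ j)) i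

/-- The noise accumulated after time `τ` is orthogonal to the square integrable
`ℱ_τ`-measurable variables. -/
theorem integral_mul_terminalValue_eq_zero (hW : IsWienerProcess ℱ P W) (hA : MatrixLInfty T A)
    (hσ : VectorLInfty T σ) (hJ : IsContinuousWienerIntegral P W T σ J) (hτt : (τ : ℝ) ≤ t)
    (ht : t ≤ T) {Z : Ω → ℝ} (hZm : Measurable[ℱ τ] Z) (hZ : MemLp Z 2 P) (i : Fin n) :
    ∫ ω, Z ω * terminalValue (volume.restrict (Ioc (τ : ℝ) t))
      (fun u => fundamentalMatrix T A t u * A u) t (fun u ω => J u ω - J τ ω) ω i ∂P = 0 := by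
  have htm : t ∈ Icc 0 T := ⟨τ.2.trans hτt, ht⟩
  have hτm : (τ : ℝ) ∈ Icc 0 T := ⟨τ.2, hτt.trans ht⟩
  have h0 : ∀ u ∈ Icc (τ : ℝ) t, ∀ a, ∫ ω, Z ω * (J u ω - J τ ω) a ∂P = 0 := by
    intro u hu a
    have hum : u ∈ Icc 0 T := ⟨τ.2.trans hu.1, hu.2.trans ht⟩
    simp only [Pi.sub_apply, mul_sub]
    rw [integral_sub (integrable_mul_of_memLp_two hZ (hJ.memLp hum a))
      (integrable_mul_of_memLp_two hZ (hJ.memLp hτm a)),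
      hJ.integral_mul_eq_of_le hW hσ hu.1 hum a hZm hZ, sub_self]
  refine (integral_mul_terminalValue (F := fun u ω => J u ω - J τ ω)
    ((memLp_top_fundamentalMatrix_mul hA hA htm).memLp_restrict_Ioc τ.2 ht)
    (hJ.memLp_prod_sub hW hσ hτt ht)
    (fun j => (hJ.memLp htm j).sub (hJ.memLp hτm j)) hZ i).trans ?_
  rw [h0 t ⟨hτt, le_rfl⟩, zero_add]
  refine integral_eq_zero_of_ae ?_
  filter_upwards [ae_restrict_mem measurableSet_Ioc] with u hu
  have e : (fun j => ∫ ω, Z ω * (J u ω - J τ ω) j ∂P) = 0 := funext fun j => h0 u ⟨hu.1.le, hu.2⟩ j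
  rw [e, Matrix.mulVec_zero]
  rfl

/-- The covariance of the noise accumulated over `(τ, t]`. By the Itô isometry the increments of
`J` have the same covariance function as the process `u ↦ 1_{(τ, u]} σ` on the measure space
`(τ, t]`, whose terminal value at `s` is `Φ_A(t, s) σ(s)` by the backward equation. -/
theorem integral_terminalValue_mul (hW : IsWienerProcess ℱ P W) (hA : MatrixLInfty T A)
    (hσ : VectorLInfty T σ) (hJ : IsContinuousWienerIntegral P W T σ J) (hτt : (τ : ℝ) ≤ t)
    (ht : t ≤ T) (i j : Fin n) :
    ∫ ω, terminalValue (volume.restrict (Ioc (τ : ℝ) t))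
        (fun u => fundamentalMatrix T A t u * A u) t (fun u ω => J u ω - J τ ω) ω i *
      terminalValue (volume.restrict (Ioc (τ : ℝ) t))
        (fun u => fundamentalMatrix T A t u * A u) t (fun u ω => J u ω - J τ ω) ω j ∂P =
    ∫ s in (τ : ℝ)..t, (fundamentalMatrix T A t s *ᵥ σ s) i *
      (fundamentalMatrix T A t s *ᵥ σ s) j := by
  have htm : t ∈ Icc 0 T := ⟨τ.2.trans hτt, ht⟩
  have hτm : (τ : ℝ) ∈ Icc 0 T := ⟨τ.2, hτt.trans ht⟩
  set ν : Measure ℝ := volume.restrict (Ioc (τ : ℝ) t) with hν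
  let G : ℝ → ℝ → Fin n → ℝ := fun u s a => (Ioc (τ : ℝ) u).indicator (fun s => σ s a) s
  have hK : ∀ i j, MemLp (fun u => (fundamentalMatrix T A t u * A u) i j) ∞ ν :=
    (memLp_top_fundamentalMatrix_mul hA hA htm).memLp_restrict_Ioc τ.2 ht
  have hσν : ∀ a, MemLp (fun s => σ s a) 2 ν := fun a =>
    ((hσ.eval a).mono_exponent le_top).mono_measure (restrict_Ioc_le_restrict_Icc τ.2 ht)
  rw [integral_terminalValue_mul_congr (F := fun u ω => J u ω - J τ ω) (P' := ν) (G := G)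
    (S := Icc (τ : ℝ) t) ?_ ⟨hτt, le_rfl⟩ hK (hJ.memLp_prod_sub hW hσ hτt ht) ?_ ?_ ?_ ?_,
    intervalIntegral.integral_of_le hτt]
  · refine integral_congr_ae ?_
    filter_upwards [ae_restrict_mem measurableSet_Ioc] with s hs
    have hsm : s ∈ Icc 0 T := ⟨τ.2.trans hs.1.le, hs.2.trans ht⟩
    -- As `1_{(τ, u]}(s) = 1_{[s, ∞)}(u)`, the functional integrates `Φ_A(t, u) A(u) σ(s)` over
    -- `u ∈ (s, t]`.
    have key : ∀ i, terminalValue ν (fun u => fundamentalMatrix T A t u * A u) t G s i =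
        (fundamentalMatrix T A t s *ᵥ σ s) i := by
      intro i
      have hint : ∀ a, IntegrableOn (fun u => (fundamentalMatrix T A t u * A u) i a)
          (Ioc s t) := fun a => ((memLp_top_fundamentalMatrix_mul hA hA htm).memLp_restrict_Ioc
            hsm.1 ht i a).integrable le_top
      have e1 : ∫ u, ((fundamentalMatrix T A t u * A u) *ᵥ G u s) i ∂ν =
          ∑ a, (∫ u in s..t, (fundamentalMatrix T A t u * A u) i a) * σ s a := by
        have hset : Icc s t = Ici s ∩ Ioc (τ : ℝ) t := by
          ext u
          simp only [mem_Icc, mem_inter_iff, mem_Ici, mem_Ioc]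
          exact ⟨fun h => ⟨h.1, hs.1.trans_le h.1, h.2⟩, fun h => ⟨h.1, h.2.2⟩⟩
        have e2 : ∀ u, ((fundamentalMatrix T A t u * A u) *ᵥ G u s) i =
            (Ici s).indicator
              (fun u => ∑ a, (fundamentalMatrix T A t u * A u) i a * σ s a) u := by
          intro u
          simp only [Matrix.mulVec, dotProduct, G]
          by_cases h : s ≤ u
          · have h1 : s ∈ Ioc (τ : ℝ) u := ⟨hs.1, h⟩
            have h2 : u ∈ Ici s := h
            simp only [indicator_of_mem h1, indicator_of_mem h2]
          · have h1 : s ∉ Ioc (τ : ℝ) u := fun h' => h h'.2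
            have h2 : u ∉ Ici s := h
            simp only [indicator_of_notMem h1, indicator_of_notMem h2, mul_zero,
              Finset.sum_const_zero]
        simp only [e2]
        rw [integral_indicator measurableSet_Ici, hν, Measure.restrict_restrict measurableSet_Ici,
          ← hset, integral_Icc_eq_integral_Ioc,
          integral_finsetSum _ fun a _ => (hint a).mul_const _]
        refine Finset.sum_congr rfl fun a _ => ?_
        rw [integral_mul_const, intervalIntegral.integral_of_le hs.2]
      have hst : s ∈ Ioc (τ : ℝ) t := hs
      simp only [terminalValue]
      rw [e1]
      simp only [G, indicator_of_mem hst]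
      simp only [Matrix.mulVec, dotProduct, fundamentalMatrix_eq_one_add_integral hA hsm htm i,
        add_mul, Finset.sum_add_distrib]
      congr 1
      simp [Matrix.one_apply]
    rw [key i, key j]
  · filter_upwards [ae_restrict_mem measurableSet_Ioc] with u hu using ⟨hu.1.le, hu.2⟩
  · exact fun u hu a => (hJ.memLp ⟨τ.2.trans hu.1, hu.2.trans ht⟩ a).sub (hJ.memLp hτm a)
  · intro a
    have hset : MeasurableSet {x : ℝ × ℝ | (τ : ℝ) < x.2 ∧ x.2 ≤ x.1} :=
      (measurableSet_lt measurable_const measurable_snd).inter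
        (measurableSet_le measurable_snd measurable_fst)
    exact ((hσν a).comp_snd ν).indicator hset
  · exact fun u _ a => (hσν a).indicator measurableSet_Ioc
  · intro u hu v hv a b
    have hum : u ∈ Icc 0 T := ⟨τ.2.trans hu.1, hu.2.trans ht⟩
    have hvm : v ∈ Icc 0 T := ⟨τ.2.trans hv.1, hv.2.trans ht⟩
    have hG : ∀ {p : ℝ} (_ : p ∈ Icc (τ : ℝ) t) (c : Fin n) (s : ℝ), G p s c =
        (Ioc 0 p).indicator (fun s => σ s c) s -
          (Ioc 0 (τ : ℝ)).indicator (fun s => σ s c) s := by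
      intro p hp c s
      have h1 := hp.1
      have h2 : (0 : ℝ) ≤ τ := τ.2
      simp only [G, indicator_apply, mem_Ioc]
      split_ifs <;> grind
    have hGν : ∫ s, G u s a * G v s b ∂ν = ∫ s, G u s a * G v s b := by
      refine setIntegral_eq_integral_of_forall_compl_eq_zero fun s hs => ?_
      have : s ∉ Ioc (τ : ℝ) u := fun h => hs ⟨h.1, h.2.trans hu.2⟩
      simp only [G, indicator_of_notMem this, zero_mul]
    rw [hGν]
    simp only [hG hu, hG hv, Pi.sub_apply]
    rw [integral_sub_mul_sub (hJ.memLp hum a) (hJ.memLp hτm a) (hJ.memLp hvm b) (hJ.memLp hτm b),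
      integral_sub_mul_sub (hσ.memLp_indicator hum.2 a) (hσ.memLp_indicator hτm.2 a)
        (hσ.memLp_indicator hvm.2 b) (hσ.memLp_indicator hτm.2 b),
      hJ.integral_mul hW hσ hum hvm, hJ.integral_mul hW hσ hum hτm,
      hJ.integral_mul hW hσ hτm hvm, hJ.integral_mul hW hσ hτm hτm]

end IsContinuousWienerIntegral

end Noise

/-! ### Pathwise representation -/

section Pathwise

variable {n : ℕ} {T : ℝ} {A : ℝ → Matrix (Fin n) (Fin n) ℝ}

theorem intervalIntegrable_mulVec {p q : ℕ} {M : ℝ → Matrix (Fin p) (Fin q) ℝ}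
    {v : ℝ → Fin q → ℝ} {s t : ℝ} (hM : ∀ i j, IntervalIntegrable (fun u => M u i j) volume s t)
    (hv : ∀ j, ContinuousOn (fun u => v u j) (uIcc s t)) (i : Fin p) :
    IntervalIntegrable (fun u => (M u *ᵥ v u) i) volume s t := by
  have : (fun u => (M u *ᵥ v u) i) = ∑ j, fun u => M u i j * v u j := by
    ext u; simp [Matrix.mulVec, dotProduct]
  rw [this]
  exact IntervalIntegrable.sum _ fun j _ => (hM i j).mul_continuousOn (hv j)

theorem intervalIntegrable_fundamentalMatrix_mulVec (hA : MatrixLInfty T A) {g : ℝ → Fin n → ℝ}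
    {s t r : ℝ} (hs : s ∈ Icc 0 T) (ht : t ∈ Icc 0 T) (hr : r ∈ Icc 0 T)
    (hg : ∀ k, IntervalIntegrable (fun u => g u k) volume s t) (i : Fin n) :
    IntervalIntegrable (fun u => (fundamentalMatrix T A r u *ᵥ g u) i) volume s t := by
  have : (fun u => (fundamentalMatrix T A r u *ᵥ g u) i) =
      ∑ j, fun u => fundamentalMatrix T A r u i j * g u j := by
    ext u; simp [Matrix.mulVec, dotProduct]
  rw [this]
  exact IntervalIntegrable.sum _ fun j _ => (hg j).continuousOn_mul
    ((continuousOn_fundamentalMatrix_right hA hr i j).mono (uIcc_subset_Icc hs ht))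

theorem IntegrableOn.intervalIntegrable_of_mem_Icc {f : ℝ → ℝ} {s t : ℝ}
    (hf : IntegrableOn f (Icc 0 T)) (hs : s ∈ Icc 0 T) (ht : t ∈ Icc 0 T) :
    IntervalIntegrable f volume s t := by
  rw [intervalIntegrable_iff]
  exact hf.mono_set (uIoc_subset_uIcc.trans (uIcc_subset_Icc hs ht))

/-- The driving path of a continuous solution of an integral equation is continuous. -/
theorem continuousOn_sub_integral (hA : MatrixLInfty T A) (hT : 0 ≤ T) {x b : ℝ → Fin n → ℝ}
    (hx : ∀ k, ContinuousOn (fun u => x u k) (Icc 0 T))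
    (hb : ∀ k, IntegrableOn (fun u => b u k) (Icc 0 T)) (k : Fin n) :
    ContinuousOn (fun u => x u k - ∫ s in (0 : ℝ)..u, ((A s *ᵥ x s) k + b s k)) (Icc 0 T) := by
  have h0 : (0 : ℝ) ∈ Icc 0 T := ⟨le_rfl, hT⟩
  have hTm : T ∈ Icc 0 T := ⟨hT, le_rfl⟩
  have hint : IntervalIntegrable (fun s => (A s *ᵥ x s) k + b s k) volume 0 T :=
    (intervalIntegrable_mulVec (fun i j => intervalIntegrable_of_memLp_top (hA i j) h0 hTm)
      (fun j => (hx j).mono (uIcc_subset_Icc h0 hTm)) k).add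
      (IntegrableOn.intervalIntegrable_of_mem_Icc (hb k) h0 hTm)
  have := intervalIntegral.continuousOn_primitive_interval' hint left_mem_uIcc
  rw [uIcc_of_le hT] at this
  exact (hx k).sub this

/-- Variation of constants for `x = x(0) + ∫ (A x + b) + j` with a merely continuous driving
path `j`: integrating by parts, the path enters through `terminalValue`. -/
theorem eq_add_terminalValue (hA : MatrixLInfty T A) {x b j : ℝ → Fin n → ℝ}
    (hx : ∀ k, ContinuousOn (fun u => x u k) (Icc 0 T))
    (hb : ∀ k, IntegrableOn (fun u => b u k) (Icc 0 T))
    (hj : ∀ u k, j u k = x u k - ∫ s in (0 : ℝ)..u, ((A s *ᵥ x s) k + b s k))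
    {τ t : ℝ} (hτ : τ ∈ Icc 0 T) (ht : t ∈ Icc 0 T) (hτt : τ ≤ t) (i : Fin n) :
    x t i = (fundamentalMatrix T A t τ *ᵥ x τ) i +
      (∫ s in τ..t, (fundamentalMatrix T A t s *ᵥ b s) i) +
      ((j t - j τ) i + ∫ u in Ioc τ t, ((fundamentalMatrix T A t u * A u) *ᵥ (j u - j τ)) i) := by
  have hT : 0 ≤ T := hτ.1.trans hτ.2
  have h0 : (0 : ℝ) ∈ Icc 0 T := ⟨le_rfl, hT⟩
  have hsub : uIcc τ t ⊆ Icc 0 T := uIcc_subset_Icc hτ ht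
  have hjc : ∀ k, ContinuousOn (fun u => j u k) (Icc 0 T) := by
    intro k
    simp only [hj]
    exact continuousOn_sub_integral hA hT hx hb k
  have hdc : ∀ k, ContinuousOn (fun u => (j u - j τ) k) (uIcc τ t) := fun k =>
    ((hjc k).mono hsub).sub continuousOn_const
  have hb' : ∀ k, IntervalIntegrable (fun u => b u k) volume τ t := fun k =>
    IntegrableOn.intervalIntegrable_of_mem_Icc (hb k) hτ ht
  have hAd : ∀ k, IntervalIntegrable (fun u => (A u *ᵥ (j u - j τ)) k) volume τ t :=
    intervalIntegrable_mulVec (fun i j => intervalIntegrable_of_memLp_top (hA i j) hτ ht) hdc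
  have hf : ∀ k {u v : ℝ}, u ∈ Icc 0 T → v ∈ Icc 0 T →
      IntervalIntegrable (fun s => (A s *ᵥ x s) k + b s k) volume u v := fun k u v hu hv =>
    (intervalIntegrable_mulVec (fun i j => intervalIntegrable_of_memLp_top (hA i j) hu hv)
      (fun j => (hx j).mono (uIcc_subset_Icc hu hv)) k).add
      (IntegrableOn.intervalIntegrable_of_mem_Icc (hb k) hu hv)
  -- After subtracting the driving path, the remainder solves an equation with integrable
  -- inhomogeneity `b + A (j - j τ)`.
  have key := variation_of_constants hA (z := fun u => x u - (j u - j τ))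
    (g := fun u => b u + A u *ᵥ (j u - j τ)) hτ ht (fun k => (hb' k).add (hAd k))
    (fun k => ((hx k).mono hsub).sub (hdc k)) (by
      intro u hu k
      have e : ∀ v, (A v *ᵥ (x v - (j v - j τ))) k + (b v + A v *ᵥ (j v - j τ)) k =
          (A v *ᵥ x v) k + b v k := fun v => by
        rw [Matrix.mulVec_sub]
        simp only [Pi.sub_apply, Pi.add_apply]
        ring
      simp only [e, Pi.sub_apply, sub_self, Pi.zero_apply, sub_zero]
      rw [hj u k, hj τ k, ← intervalIntegral.integral_interval_sub_left
        (hf k h0 (hsub hu)) (hf k h0 hτ)]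
      ring)
  have h := congrFun key i
  simp only [sub_self, sub_zero, Pi.add_apply, Pi.sub_apply, Matrix.mulVec_add,
    Matrix.mulVec_mulVec] at h
  have i2 : IntervalIntegrable
      (fun u => ((fundamentalMatrix T A t u * A u) *ᵥ (j u - j τ)) i) volume τ t := by
    simp only [← Matrix.mulVec_mulVec]
    exact intervalIntegrable_fundamentalMatrix_mulVec hA hτ ht ht hAd i
  rw [intervalIntegral.integral_add
    (intervalIntegrable_fundamentalMatrix_mulVec hA hτ ht ht hb' i) i2,
    intervalIntegral.integral_of_le (f := fun u => (_ *ᵥ (j u - j τ)) i) hτt] at h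
  simp only [Pi.sub_apply]
  linarith

/-- By the cocycle property, inputs over `(τ, t]` act at time `t` as if collected at time `τ`. -/
theorem integral_fundamentalMatrix_mulVec (hA : MatrixLInfty T A) {g : ℝ → Fin n → ℝ}
    {τ t : ℝ} (hτ : τ ∈ Icc 0 T) (ht : t ∈ Icc 0 T)
    (hg : ∀ k, IntervalIntegrable (fun u => g u k) volume τ t) (i : Fin n) :
    ∫ s in τ..t, (fundamentalMatrix T A t s *ᵥ g s) i =
      (fundamentalMatrix T A t τ *ᵥ
        fun a => ∫ s in τ..t, (fundamentalMatrix T A τ s *ᵥ g s) a) i := by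
  have e : ∀ s ∈ uIcc τ t, (fundamentalMatrix T A t s *ᵥ g s) i =
      ∑ a, fundamentalMatrix T A t τ i a * (fundamentalMatrix T A τ s *ᵥ g s) a := by
    intro s hs
    rw [← fundamentalMatrix_mul hA (uIcc_subset_Icc hτ ht hs) hτ ht, ← Matrix.mulVec_mulVec]
    rfl
  rw [intervalIntegral.integral_congr e, intervalIntegral.integral_finsetSum fun a _ =>
    (intervalIntegrable_fundamentalMatrix_mulVec hA hτ ht hτ hg a).const_mul _]
  simp only [intervalIntegral.integral_const_mul]
  rfl

end Pathwise

/-! ### Covariance of affine images -/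

section Covariance

variable {Ω : Type*} {mΩ : MeasurableSpace Ω} {P : Measure Ω}

theorem covariance_congr_ae {f f' g g' : Ω → ℝ} (hf : f =ᵐ[P] f') (hg : g =ᵐ[P] g') :
    cov[f, g; P] = cov[f', g'; P] := by
  simp only [covariance, integral_congr_ae hf, integral_congr_ae hg]
  refine integral_congr_ae ?_
  filter_upwards [hf, hg] with ω h1 h2
  rw [h1, h2]

/-- Adding a constant and uncorrelated noise to a linear image of `Y` adds the covariance of the
noise to the transformed covariance of `Y`. -/
theorem covariance_mulVec_add_const_add [IsProbabilityMeasure P] {n : ℕ}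
    {M : Matrix (Fin n) (Fin n) ℝ} {c : Fin n → ℝ} {X Y N : Ω → Fin n → ℝ}
    (hX : ∀ᵐ ω ∂P, ∀ i, X ω i = (M *ᵥ Y ω) i + c i + N ω i)
    (hY : ∀ i, MemLp (fun ω => Y ω i) 2 P) (hN : ∀ i, MemLp (fun ω => N ω i) 2 P)
    (hYN : ∀ i j, cov[fun ω => Y ω i, fun ω => N ω j; P] = 0) (i j : Fin n) :
    cov[fun ω => X ω i, fun ω => X ω j; P] =
      (M * (Matrix.of fun i j => cov[fun ω => Y ω i, fun ω => Y ω j; P]) * Mᵀ) i j +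
        cov[fun ω => N ω i, fun ω => N ω j; P] := by
  let R : Fin n → Ω → ℝ := fun i ω => ∑ a, M i a * Y ω a
  let N' : Fin n → Ω → ℝ := fun i ω => N ω i
  have hR : ∀ i, MemLp (R i) 2 P := fun i => memLp_finsetSum _ fun a _ => (hY a).const_mul _
  have hN' : ∀ i, MemLp (N' i) 2 P := hN
  have hRN : ∀ i, MemLp (R i + N' i) 2 P := fun i => (hR i).add (hN' i)
  have e : ∀ i, (fun ω => X ω i) =ᵐ[P] fun ω => (R i + N' i) ω + c i := by
    intro i
    filter_upwards [hX] with ω hω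
    rw [hω i]
    simp only [R, N', Pi.add_apply, Matrix.mulVec, dotProduct]
    ring
  have hRN0 : ∀ i j, cov[R i, N' j; P] = 0 := by
    intro i j
    refine (covariance_fun_sum_left (fun a => (hY a).const_mul _) (hN j)).trans ?_
    refine Finset.sum_eq_zero fun a _ => ?_
    rw [covariance_const_mul_left, hYN, mul_zero]
  have hRR : ∀ i j, cov[R i, R j; P] =
      (M * (Matrix.of fun i j => cov[fun ω => Y ω i, fun ω => Y ω j; P]) * Mᵀ) i j := by
    intro i j
    refine (covariance_fun_sum_fun_sum (fun a => (hY a).const_mul _)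
      (fun a => (hY a).const_mul _)).trans ?_
    simp only [covariance_const_mul_left, covariance_const_mul_right, Matrix.mul_apply,
      Matrix.transpose_apply, Matrix.of_apply, Finset.sum_mul]
    rw [Finset.sum_comm]
    refine Finset.sum_congr rfl fun b _ => Finset.sum_congr rfl fun a _ => ?_
    ring
  rw [covariance_congr_ae (e i) (e j),
    covariance_add_const_left ((hRN i).integrable (by norm_num)),
    covariance_add_const_right ((hRN j).integrable (by norm_num)),
    covariance_add_left (hR i) (hN' i) (hRN j), covariance_add_right (hR i) (hR j) (hN' j),
    covariance_add_right (hN' i) (hR j) (hN' j), covariance_comm (N' i) (R j), hRN0, hRN0, hRR]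
  simp only [add_zero, zero_add]
  rfl

end Covariance

/-! ### The delayed equation -/

section Delayed

variable {Ω : Type*} {mΩ : MeasurableSpace Ω} {P : Measure Ω}
  {ℱ : Filtration ℝ≥0 mΩ} {W : ℝ≥0 → Ω → ℝ} {n m : ℕ} {T h : ℝ}
  {A : ℝ → Matrix (Fin n) (Fin n) ℝ} {B : ℝ → Matrix (Fin n) (Fin m) ℝ} {r σ : ℝ → Fin n → ℝ}
  {U : ℝ → Ω → Fin m → ℝ} {X : ℝ → Ω → Fin n → ℝ}

/-- The stochastic part of a solution of the delayed equation: the solution minus its drift. -/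
noncomputable def noisePart (h : ℝ) (A : ℝ → Matrix (Fin n) (Fin n) ℝ)
    (B : ℝ → Matrix (Fin n) (Fin m) ℝ) (r : ℝ → Fin n → ℝ) (U : ℝ → Ω → Fin m → ℝ)
    (X : ℝ → Ω → Fin n → ℝ) (u : ℝ) (ω : Ω) : Fin n → ℝ :=
  fun k => X u ω k -
    ∫ s in (0 : ℝ)..u, ((A s *ᵥ X s ω) k + (B s *ᵥ U (s - h) ω + r s) k)

/-- The noise accumulated by the solution over `(τ, t]`, transported to time `t`; it is a version
of `∫_τ^t Φ_A(t,s) σ(s) dW_s`. -/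
noncomputable def accumulatedNoise (T h : ℝ) (A : ℝ → Matrix (Fin n) (Fin n) ℝ)
    (B : ℝ → Matrix (Fin n) (Fin m) ℝ) (r : ℝ → Fin n → ℝ) (U : ℝ → Ω → Fin m → ℝ)
    (X : ℝ → Ω → Fin n → ℝ) (τ t : ℝ) : Ω → Fin n → ℝ :=
  terminalValue (volume.restrict (Ioc τ t)) (fun u => fundamentalMatrix T A t u * A u) t
    (fun u ω => noisePart h A B r U X u ω - noisePart h A B r U X τ ω)

theorem MatrixLInfty.mulVec_integrableOn {p q : ℕ} {M : ℝ → Matrix (Fin p) (Fin q) ℝ}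
    (hM : MatrixLInfty T M) {v : ℝ → Fin q → ℝ} (hv : ∀ j, IntegrableOn (fun u => v u j) (Icc 0 T))
    (i : Fin p) : IntegrableOn (fun u => (M u *ᵥ v u) i) (Icc 0 T) := by
  simp only [Matrix.mulVec, dotProduct]
  exact integrable_finsetSum _ fun j _ => memLp_one_iff_integrable.1
    ((memLp_one_iff_integrable.2 (hv j)).mul (hM i j))

theorem VectorLInfty.integrableOn {p : ℕ} {v : ℝ → Fin p → ℝ} (hv : VectorLInfty T v)
    (k : Fin p) : IntegrableOn (fun s => v s k) (Icc 0 T) :=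
  (hv.eval k).integrable le_top

/-- Up to time `τ + h` the delayed control only uses information available at time `τ`. -/
theorem MemL2Adapted.measurable_delay (hU : MemL2Adapted ℱ P T U)
    (hU0 : ∀ s ∈ Ico (-h) 0, ∀ ω, U s ω = 0) {τ : ℝ≥0} (hτ : (τ : ℝ) ≤ T) {s : ℝ} (hs : 0 ≤ s)
    (hsτ : s - h ≤ τ) (l : Fin m) : Measurable[ℱ τ] (fun ω => U (s - h) ω l) := by
  rcases lt_or_ge (s - h) 0 with hneg | hpos
  · have : (fun ω => U (s - h) ω l) = fun _ => 0 := by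
      ext ω
      rw [hU0 (s - h) ⟨by linarith, hneg⟩]
      rfl
    rw [this]
    exact measurable_const
  · have h1 := hU.adapted ⟨s - h, hpos⟩ (hsτ.trans hτ)
    exact ((measurable_pi_apply l).comp h1).mono (ℱ.mono hsτ) le_rfl

theorem IsDelayedSolution.continuousOn_apply (hX : IsDelayedSolution ℱ P W T h A B r σ U X) :
    ∀ᵐ ω ∂P, ∀ k, ContinuousOn (fun t => X t ω k) (Icc 0 T) := by
  filter_upwards [hX.continuousOn] with ω hω k
  exact (continuous_apply k).comp_continuousOn hω

variable [IsProbabilityMeasure P]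

/-- On `[0, h)` the delayed control vanishes, and on `[h, T]` it is a shift of `U`. -/
theorem MemL2Adapted.memLp_delay (hU : MemL2Adapted ℱ P T U) (hh : 0 < h)
    (hU0 : ∀ s ∈ Ico (-h) 0, ∀ ω, U s ω = 0) (l : Fin m) :
    MemLp (fun x : ℝ × Ω => U (x.1 - h) x.2 l) 2 ((volume.restrict (Icc 0 T)).prod P) := by
  have h1 : MemLp (fun x : ℝ × Ω => U x.1 x.2 l) 2 ((volume.restrict (Icc 0 (T - h))).prod P) :=
    (hU.memLp.eval l).mono_measure (Measure.prod_mono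
      (Measure.restrict_mono_set _ (Icc_subset_Icc le_rfl (by linarith))) le_rfl)
  have hpre : (fun s : ℝ => s - h) ⁻¹' Icc 0 (T - h) = Icc h T := by
    simp
  have hmp : MeasurePreserving (fun s : ℝ => s - h) (volume.restrict (Icc h T))
      (volume.restrict (Icc 0 (T - h))) := by
    rw [← hpre]
    exact (measurePreserving_sub_right volume h).restrict_preimage measurableSet_Icc
  have h2 := h1.comp_measurePreserving (hmp.prod (MeasurePreserving.id P))
  have hset : MeasurableSet (Icc h T ×ˢ (univ : Set Ω)) := measurableSet_Icc.prod .univ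
  have h3 : MemLp ((Icc h T ×ˢ (univ : Set Ω)).indicator
      fun x : ℝ × Ω => U (x.1 - h) x.2 l) 2 ((volume.restrict (Icc 0 T)).prod P) := by
    rw [memLp_indicator_iff_restrict hset, ← Measure.prod_restrict, Measure.restrict_univ,
      Measure.restrict_restrict measurableSet_Icc,
      inter_eq_left.2 (Icc_subset_Icc hh.le le_rfl)]
    exact h2
  refine h3.ae_eq ?_
  filter_upwards [Measure.quasiMeasurePreserving_fst.ae (ae_restrict_mem measurableSet_Icc)]
    with x hx
  by_cases hxh : h ≤ x.1
  · rw [indicator_of_mem (show x ∈ Icc h T ×ˢ (univ : Set Ω) from ⟨⟨hxh, hx.2⟩, mem_univ _⟩)]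
  · rw [indicator_of_notMem (fun h' => hxh h'.1.1),
      hU0 (x.1 - h) ⟨by linarith [hx.1], by linarith⟩]
    rfl

theorem ae_integrableOn_delay (hU : MemL2Adapted ℱ P T U) (hh : 0 < h)
    (hU0 : ∀ s ∈ Ico (-h) 0, ∀ ω, U s ω = 0) :
    ∀ᵐ ω ∂P, ∀ l, IntegrableOn (fun s => U (s - h) ω l) (Icc 0 T) :=
  ae_all_iff.2 fun l =>
    ae_integrable_of_memLp_prod (F := fun s ω => U (s - h) ω l) (hU.memLp_delay hh hU0 l)

namespace IsDelayedSolution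

theorem ae_integrableOn_input (hX : IsDelayedSolution ℱ P W T h A B r σ U X) (hh : 0 < h)
    (hB : MatrixLInfty T B) (hr : VectorLInfty T r) (hU : MemL2Adapted ℱ P T U) :
    ∀ᵐ ω ∂P, ∀ k, IntegrableOn (fun s => (B s *ᵥ U (s - h) ω + r s) k) (Icc 0 T) := by
  filter_upwards [ae_integrableOn_delay hU hh hX.control_prehistory] with ω hω k
  exact (hB.mulVec_integrableOn hω k).add (hr.integrableOn k)

/-- At each time the noise part is a Wiener integral, by the equation, and its paths are continuous
because those of the solution and of its drift are. -/
theorem isContinuousWienerIntegral_noisePart (hX : IsDelayedSolution ℱ P W T h A B r σ U X)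
    (hh : 0 < h) (hT : 0 ≤ T) (hA : MatrixLInfty T A) (hB : MatrixLInfty T B)
    (hr : VectorLInfty T r) (hU : MemL2Adapted ℱ P T U) :
    IsContinuousWienerIntegral P W T σ (noisePart h A B r U X) where
  version := by
    intro u hu
    have h0 : (0 : ℝ) ∈ Icc 0 T := ⟨le_rfl, hT⟩
    obtain ⟨I, hI, e⟩ := hX.equation u hu
    refine ⟨I, hI, ?_⟩
    filter_upwards [e, hX.continuousOn_apply, hX.ae_integrableOn_input hh hB hr hU]
      with ω hω hc hi
    ext k
    have hint : ∀ k, IntervalIntegrable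
        (fun s => (A s *ᵥ X s ω + B s *ᵥ U (s - h) ω + r s) k) volume 0 u := fun k => by
      simp only [add_assoc]
      exact (intervalIntegrable_mulVec
        (fun i j => intervalIntegrable_of_memLp_top (hA i j) h0 hu)
        (fun j => (hc j).mono (uIcc_subset_Icc h0 hu)) k).add
        (IntegrableOn.intervalIntegrable_of_mem_Icc (hi k) h0 hu)
    have e2 : (∫ s in (0 : ℝ)..u, (A s *ᵥ X s ω + B s *ᵥ U (s - h) ω + r s)) k =
        ∫ s in (0 : ℝ)..u, ((A s *ᵥ X s ω) k + (B s *ᵥ U (s - h) ω + r s) k) := by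
      rw [intervalIntegral.integral_of_le hu.1, intervalIntegral.integral_of_le hu.1,
        eval_integral fun k => ((hint k).1)]
      refine integral_congr_ae (ae_of_all _ fun s => ?_)
      simp only [Pi.add_apply]
      ring
    rw [noisePart, hω, Pi.add_apply, e2]
    simp
  continuousOn := by
    filter_upwards [hX.continuousOn_apply, hX.ae_integrableOn_input hh hB hr hU] with ω hc hi k
    exact continuousOn_sub_integral hA hT hc hi k

/-- Variation of constants on `[τ, t]`. The contribution of the control over `(τ, t]` is pulled
back to time `τ` and combined with the state there. -/
theorem ae_eq_add_accumulatedNoise (hX : IsDelayedSolution ℱ P W T h A B r σ U X)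
    (hh : 0 < h) (hA : MatrixLInfty T A) (hB : MatrixLInfty T B)
    (hr : VectorLInfty T r) (hU : MemL2Adapted ℱ P T U) {τ t : ℝ} (hτ : τ ∈ Icc 0 T)
    (ht : t ∈ Icc 0 T) (hτt : τ ≤ t) :
    ∀ᵐ ω ∂P, ∀ i, X t ω i = (fundamentalMatrix T A t τ *ᵥ fun a => X τ ω a +
        ∫ s in τ..t, ((fundamentalMatrix T A τ s * B s) *ᵥ U (s - h) ω) a) i +
      (∫ s in τ..t, (fundamentalMatrix T A t s *ᵥ r s) i) +
      accumulatedNoise T h A B r U X τ t ω i := by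
  filter_upwards [hX.continuousOn_apply, hX.ae_integrableOn_input hh hB hr hU,
    ae_integrableOn_delay hU hh hX.control_prehistory] with ω hc hi hv i
  have key := eq_add_terminalValue hA hc hi (j := fun u => noisePart h A B r U X u ω)
    (fun u k => rfl) hτ ht hτt i
  have iB : ∀ k, IntervalIntegrable (fun s => (B s *ᵥ U (s - h) ω) k) volume τ t := fun k =>
    IntegrableOn.intervalIntegrable_of_mem_Icc (hB.mulVec_integrableOn hv k) hτ ht
  have ir : ∀ k, IntervalIntegrable (fun s => r s k) volume τ t := fun k =>
    IntegrableOn.intervalIntegrable_of_mem_Icc (hr.integrableOn k) hτ ht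
  rw [key]
  simp only [Matrix.mulVec_add, Pi.add_apply]
  rw [intervalIntegral.integral_add
    (intervalIntegrable_fundamentalMatrix_mulVec hA hτ ht ht iB i)
    (intervalIntegrable_fundamentalMatrix_mulVec hA hτ ht ht ir i),
    integral_fundamentalMatrix_mulVec hA hτ ht iB]
  have e : (fun a => X τ ω a +
      ∫ s in τ..t, ((fundamentalMatrix T A τ s * B s) *ᵥ U (s - h) ω) a) =
      X τ ω + fun a => ∫ s in τ..t, (fundamentalMatrix T A τ s *ᵥ B s *ᵥ U (s - h) ω) a := by
    ext a
    simp only [Pi.add_apply, Matrix.mulVec_mulVec]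
  rw [e, Matrix.mulVec_add, Pi.add_apply, accumulatedNoise, terminalValue]
  ring

theorem memLp_integral_control (hX : IsDelayedSolution ℱ P W T h A B r σ U X)
    (hh : 0 < h) (hA : MatrixLInfty T A) (hB : MatrixLInfty T B)
    (hU : MemL2Adapted ℱ P T U) {τ t : ℝ} (hτ : τ ∈ Icc 0 T)
    (ht : t ∈ Icc 0 T) (hτt : τ ≤ t) (a : Fin n) :
    MemLp (fun ω => ∫ s in τ..t, ((fundamentalMatrix T A τ s * B s) *ᵥ U (s - h) ω) a) 2 P := by
  simp only [intervalIntegral.integral_of_le hτt]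
  refine memLp_integral_of_memLp_prod (memLp_prod_mulVec (H := fun s ω => U (s - h) ω)
    ((memLp_top_fundamentalMatrix_mul hA hB hτ).memLp_restrict_Ioc hτ.1 ht.2) (fun l => ?_) a)
  exact memLp_prod_restrict_Ioc (F := fun s ω => U (s - h) ω l)
    (hU.memLp_delay hh hX.control_prehistory l) hτ.1 ht.2

/-- The solution is square integrable: variation of constants from time `0` expresses it by the
control and the noise alone. -/
theorem memLp_apply (hX : IsDelayedSolution ℱ P W T h A B r σ U X) (hW : IsWienerProcess ℱ P W)
    (hh : 0 < h) (hA : MatrixLInfty T A) (hB : MatrixLInfty T B) (hr : VectorLInfty T r)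
    (hσ : VectorLInfty T σ) (hU : MemL2Adapted ℱ P T U) {t : ℝ} (ht : t ∈ Icc 0 T) (i : Fin n) :
    MemLp (fun ω => X t ω i) 2 P := by
  have h0 : (0 : ℝ) ∈ Icc 0 T := ⟨le_rfl, ht.1.trans ht.2⟩
  have hJ := hX.isContinuousWienerIntegral_noisePart hh h0.2 hA hB hr hU
  have hN := hJ.memLp_terminalValue (τ := 0) hW hA hσ ht.1 ht.2 i
  have hC : MemLp (fun ω => (fundamentalMatrix T A t 0 *ᵥ fun a =>
      ∫ s in (0 : ℝ)..t, ((fundamentalMatrix T A 0 s * B s) *ᵥ U (s - h) ω) a) i) 2 P := by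
    simp only [Matrix.mulVec, dotProduct]
    exact memLp_finsetSum _ fun a _ =>
      (hX.memLp_integral_control hh hA hB hU h0 ht ht.1 a).const_mul _
  refine ((hC.add (memLp_const (∫ s in (0 : ℝ)..t, (fundamentalMatrix T A t s *ᵥ r s) i))).add
    hN).ae_eq ?_
  filter_upwards [hX.ae_eq_add_accumulatedNoise hh hA hB hr hU h0 ht ht.1, hX.initial]
    with ω hω hω0
  rw [hω i]
  simp only [hω0, Pi.zero_apply, zero_add]
  rfl

/-- The Artstein transform, with the control integral moved to the window `(t, t + h]` in which
the control acts. -/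
theorem ae_artsteinTransform_eq (hX : IsDelayedSolution ℱ P W T h A B r σ U X)
    (hh : 0 < h) (hA : MatrixLInfty T A) (hB : MatrixLInfty T B)
    (hU : MemL2Adapted ℱ P T U) {t : ℝ} (ht : t ∈ Icc h T) :
    ∀ᵐ ω ∂P, artsteinTransform T h A B U X (t - h) ω = fun a => X (t - h) ω a +
      ∫ s in (t - h)..t, ((fundamentalMatrix T A (t - h) s * B s) *ᵥ U (s - h) ω) a := by
  have hτ : t - h ∈ Icc 0 T := ⟨by linarith [ht.1], by linarith [ht.2]⟩
  have htm : t ∈ Icc 0 T := ⟨hh.le.trans ht.1, ht.2⟩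
  filter_upwards [ae_integrableOn_delay hU hh hX.control_prehistory] with ω hv
  have e := intervalIntegral.integral_comp_sub_right (a := t - h) (b := t) (fun s =>
    (fundamentalMatrix T A (t - h) (s + h) * B (s + h)) *ᵥ U s ω) h
  simp only [sub_add_cancel] at e
  have hint : ∀ k, IntervalIntegrable
      (fun s => ((fundamentalMatrix T A (t - h) s * B s) *ᵥ U (s - h) ω) k) volume (t - h) t :=
    fun k => IntegrableOn.intervalIntegrable_of_mem_Icc
      ((memLp_top_fundamentalMatrix_mul hA hB hτ).mulVec_integrableOn hv k) hτ htm
  have hle : t - h ≤ t := by linarith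
  ext a
  rw [artsteinTransform, ← e, Pi.add_apply, intervalIntegral.integral_of_le hle,
    intervalIntegral.integral_of_le hle, eval_integral fun k => (hint k).1]

/-- The Artstein transform at time `τ = t - h` is uncorrelated with the noise accumulated over
`(τ, t]`: both the state and, by Fubini's theorem, the stored control are built from
`ℱ_τ`-measurable variables. -/
theorem integral_artstein_mul_accumulatedNoise (hX : IsDelayedSolution ℱ P W T h A B r σ U X)
    (hW : IsWienerProcess ℱ P W) (hh : 0 < h) (hA : MatrixLInfty T A) (hB : MatrixLInfty T B)
    (hr : VectorLInfty T r) (hσ : VectorLInfty T σ) (hU : MemL2Adapted ℱ P T U) {τ : ℝ≥0} {t : ℝ}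
    (ht : t ≤ T) (hτt : (τ : ℝ) = t - h) (a j : Fin n) :
    ∫ ω, (X τ ω a + ∫ s in (τ : ℝ)..t,
        ((fundamentalMatrix T A τ s * B s) *ᵥ U (s - h) ω) a) *
      accumulatedNoise T h A B r U X τ t ω j ∂P = 0 := by
  have hle : (τ : ℝ) ≤ t := by linarith
  have hτm : (τ : ℝ) ∈ Icc 0 T := ⟨τ.2, hle.trans ht⟩
  have htm : t ∈ Icc 0 T := ⟨τ.2.trans hle, ht⟩
  have hJ := hX.isContinuousWienerIntegral_noisePart hh (hτm.1.trans hτm.2) hA hB hr hU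
  have hN : MemLp (fun ω => accumulatedNoise T h A B r U X τ t ω j) 2 P :=
    hJ.memLp_terminalValue hW hA hσ hle ht j
  have hZ : ∀ {Z : Ω → ℝ}, Measurable[ℱ τ] Z → MemLp Z 2 P →
      ∫ ω, accumulatedNoise T h A B r U X τ t ω j * Z ω ∂P = 0 := by
    intro Z hZm hZ
    simp only [mul_comm _ (Z _)]
    exact hJ.integral_mul_terminalValue_eq_zero hW hA hσ hle ht hZm hZ j
  have hXm := hX.memLp_apply hW hh hA hB hr hσ hU hτm a
  have hC := hX.memLp_integral_control hh hA hB hU hτm htm hle a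
  have hV : ∀ l, MemLp (fun x : ℝ × Ω => U (x.1 - h) x.2 l) 2
      ((volume.restrict (Ioc (τ : ℝ) t)).prod P) := fun l =>
    memLp_prod_restrict_Ioc (F := fun s ω => U (s - h) ω l)
      (hU.memLp_delay hh hX.control_prehistory l) hτm.1 ht
  have h1 : ∫ ω, accumulatedNoise T h A B r U X τ t ω j * X τ ω a ∂P = 0 :=
    hZ ((measurable_pi_apply a).comp (hX.adapted τ hτm.2)) hXm
  have h2 : ∫ ω, accumulatedNoise T h A B r U X τ t ω j * (∫ s in (τ : ℝ)..t,
      ((fundamentalMatrix T A τ s * B s) *ᵥ U (s - h) ω) a) ∂P = 0 := by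
    simp only [intervalIntegral.integral_of_le hle]
    rw [integral_mul_integral_mulVec (H := fun s ω => U (s - h) ω)
      ((memLp_top_fundamentalMatrix_mul hA hB hτm).memLp_restrict_Ioc hτm.1 ht) hV hN a]
    refine integral_eq_zero_of_ae ?_
    filter_upwards [ae_restrict_mem measurableSet_Ioc, ae_all_iff.2 fun l =>
      ae_memLp_of_memLp_prod (F := fun s ω => U (s - h) ω l) (hV l)] with s hs hsm
    have e : (fun l => ∫ ω, accumulatedNoise T h A B r U X τ t ω j * U (s - h) ω l ∂P) = 0 :=
      funext fun l => hZ (hU.measurable_delay hX.control_prehistory hτm.2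
        (τ.2.trans hs.1.le) (by linarith [hs.2]) l) (hsm l)
    rw [e, Matrix.mulVec_zero]
    rfl
  simp only [mul_comm _ (accumulatedNoise _ _ _ _ _ _ _ _ _ _ _), mul_add]
  rw [integral_add (integrable_mul_of_memLp_two hN hXm) (integrable_mul_of_memLp_two hN hC), h1,
    h2, add_zero]

end IsDelayedSolution

end Delayed

end DelayedSDE

/-! ### The covariance identity -/

theorem mainTheorem2 {Ω : Type*} {mΩ : MeasurableSpace Ω} (P : Measure Ω) [IsProbabilityMeasure P]
    (ℱ : Filtration ℝ≥0 mΩ) (W : ℝ≥0 → Ω → ℝ) (hW : DelayedSDE.IsWienerProcess ℱ P W)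
    (n m : ℕ) (T h : ℝ) (hh : 0 < h) (hhT : h < T)
    (A : ℝ → Matrix (Fin n) (Fin n) ℝ) (B : ℝ → Matrix (Fin n) (Fin m) ℝ) (r σ : ℝ → Fin n → ℝ)
    (hA : DelayedSDE.MatrixLInfty T A) (hB : DelayedSDE.MatrixLInfty T B)
    (hr : DelayedSDE.VectorLInfty T r) (hσ : DelayedSDE.VectorLInfty T σ)
    (U : ℝ → Ω → Fin m → ℝ) (hU : DelayedSDE.MemL2Adapted ℱ P T U)
    (X : ℝ → Ω → Fin n → ℝ) (hX : DelayedSDE.IsDelayedSolution ℱ P W T h A B r σ U X)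
    (Y : ℝ → Ω → Fin n → ℝ) (hY : Y = DelayedSDE.artsteinTransform T h A B U X) :
    ∀ t ∈ Icc h T,
      MemLp (X t) 2 P ∧ MemLp (Y (t - h)) 2 P ∧
      DelayedSDE.covMatrix P X t =
        DelayedSDE.fundamentalMatrix T A t (t - h) * DelayedSDE.covMatrix P Y (t - h) *
            (DelayedSDE.fundamentalMatrix T A t (t - h))ᵀ +
          DelayedSDE.sigmaMin T h A σ t := by
  intro t ht
  have hle : t - h ≤ t := by linarith
  have hτm : t - h ∈ Icc 0 T := ⟨by linarith [ht.1], by linarith [ht.2]⟩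
  have htm : t ∈ Icc 0 T := ⟨hh.le.trans ht.1, ht.2⟩
  have hXL : ∀ {u}, u ∈ Icc 0 T → ∀ i, MemLp (fun ω => X u ω i) 2 P := fun hu =>
    hX.memLp_apply hW hh hA hB hr hσ hU hu
  have hYe : ∀ᵐ ω ∂P, Y (t - h) ω = fun a => X (t - h) ω a +
      ∫ s in (t - h)..t, ((DelayedSDE.fundamentalMatrix T A (t - h) s * B s) *ᵥ U (s - h) ω) a :=
    hY ▸ hX.ae_artsteinTransform_eq hh hA hB hU ht
  have hYL : ∀ i, MemLp (fun ω => Y (t - h) ω i) 2 P := fun i => by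
    refine ((hXL hτm i).add
      (hX.memLp_integral_control hh hA hB hU hτm htm hle i)).ae_eq ?_
    filter_upwards [hYe] with ω hω
    rw [hω]
    rfl
  refine ⟨MemLp.of_eval fun i => hXL htm i, MemLp.of_eval hYL, ?_⟩
  obtain ⟨τ, hτ⟩ : ∃ τ : ℝ≥0, (τ : ℝ) = t - h := ⟨⟨t - h, hτm.1⟩, rfl⟩
  rw [← hτ] at hle hτm hYe hYL ⊢
  have hJ := hX.isContinuousWienerIntegral_noisePart hh (htm.1.trans htm.2) hA hB hr hU
  set N := DelayedSDE.accumulatedNoise T h A B r U X τ t with hN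
  have hNL : ∀ i, MemLp (fun ω => N ω i) 2 P := fun i =>
    hJ.memLp_terminalValue hW hA hσ hle htm.2 i
  have hN0 : ∀ i, ∫ ω, N ω i ∂P = 0 := fun i => by
    have h1 := hJ.integral_mul_terminalValue_eq_zero hW hA hσ hle htm.2
      (Z := fun _ => 1) measurable_const (memLp_const 1) i
    simp only [one_mul] at h1
    exact h1
  have hcov : ∀ {f : Ω → ℝ}, MemLp f 2 P → ∀ j, cov[f, fun ω => N ω j; P] =
      ∫ ω, f ω * N ω j ∂P := fun hf j => by
    rw [covariance_eq_sub hf (hNL j), hN0, mul_zero, sub_zero]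
    rfl
  have hYN : ∀ i j, cov[fun ω => Y τ ω i, fun ω => N ω j; P] = 0 := fun i j => by
    rw [hcov (hYL i), ← hX.integral_artstein_mul_accumulatedNoise hW hh hA hB hr hσ hU htm.2 hτ i j]
    refine integral_congr_ae ?_
    filter_upwards [hYe] with ω hω
    rw [hω]
  have hXe : ∀ᵐ ω ∂P, ∀ i, X t ω i = (DelayedSDE.fundamentalMatrix T A t τ *ᵥ Y τ ω) i +
      (∫ s in (τ : ℝ)..t, (DelayedSDE.fundamentalMatrix T A t s *ᵥ r s) i) + N ω i := by
    filter_upwards [hX.ae_eq_add_accumulatedNoise hh hA hB hr hU hτm htm hle, hYe] with ω h1 h2 i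
    rw [h1 i, h2]
  ext i j
  refine (DelayedSDE.covariance_mulVec_add_const_add hXe hYL hNL hYN i j).trans ?_
  rw [Matrix.add_apply, hcov (hNL i) j]
  congr 1
  refine (hJ.integral_terminalValue_mul hW hA hσ hle htm.2 i j).trans ?_
  rw [DelayedSDE.sigmaMin, Matrix.of_apply, ← hτ]
  refine intervalIntegral.integral_congr fun s _ => ?_
  simp only [Matrix.mul_vecMulVec, Matrix.vecMulVec_mul, Matrix.vecMul_transpose,
    Matrix.vecMulVec_apply]
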